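/- Let $d\ge 3$ and let $E_d$ be the set of non-oriented nearest-neighbour edges of $\mathbb Z^d$. Let the conductances $(\omega(e))_{e\in E_d}$ be independent and identically distributed random variables with values in $[0,\infty)$, bounded from above by a deterministic constant and almost surely strictly positive, and let $Q$ be the law of the environment $\omega=(\omega(e))_{e\in E_d}$. Put $m^\omega(x)=\sum_{z\sim x}\omega(x,z)$ and $m^\omega(B)=\sum_{x\in B}m^\omega(x)$. Let $(X_k)_{k\ge 0}$ be, under $\mathbb P_0^\omega$ (with expectation $\mathbb E_0^\omega$), the discrete-time random walk on $\mathbb Z^d$ started at $0$ with transition probabilities $p^\omega(x,y)=\omega(x,y)/m^\omega(x)$ for $x\sim y$, and for $B\subset\mathbb Z^d$ let $l_B=\operatorname{card}\{k\in\mathbb N : X_k\in B\}$ (with $0\in\mathbb N$) be the occupation time of $B$. Then there is a constant $C=C(Q,d)\in(0,\infty)$ such that, for $Q$-almost every environment $\omega$, there is $N_\omega\in\mathbb N$ such that every connected set $B\subset\mathbb Z^d$ (connected in the nearest-neighbour graph) with $0\in B$ and $m^\omega(B)\ge N_\omega$ satisfies $$\mathbb E_0^\omega(l_B)\le C\,m^\omega(B)^{2/d}.$$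 (For infinite $B$ both sides are allowed to take the value $+\infty$.) -/

import Mathlib

open MeasureTheory ProbabilityTheory
open scoped NNReal ENNReal

/-- The lattice `ℤ^d`: two points are neighbours when their `ℓ¹` distance is `1`. -/
def latticeGraph (d : ℕ) : SimpleGraph (Fin d → ℤ) where
  Adj x y := ∑ i, |x i - y i| = 1
  symm := ⟨fun x y h => by simpa only [abs_sub_comm] using h⟩
  loopless := ⟨fun x h => by simp at h⟩

/-- An environment assigns a nonnegative conductance to every non-oriented edge of `ℤ^d`. -/
abbrev Environment (d : ℕ) : Type := (latticeGraph d).edgeSet → ℝ≥0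

/-- The law of an environment with independent conductances of common law `ν`. -/
noncomputable def iidLaw (d : ℕ) (ν : Measure ℝ≥0) : Measure (Environment d) :=
  Measure.infinitePi fun _ => ν

namespace Environment

variable {d : ℕ}

open Classical in
/-- The conductance `ω(x, y)`, extended by `0` to pairs that are not neighbours. -/
noncomputable def cond (ω : Environment d) (x y : Fin d → ℤ) : ℝ≥0∞ :=
  if h : (latticeGraph d).Adj x y then (ω ⟨s(x, y), h⟩ : ℝ≥0∞) else 0

/-- The reversible measure of a point, `m^ω(x) = ∑_{z ∼ x} ω(x, z)`. -/
noncomputable def mass (ω : Environment d) (x : Fin d → ℤ) : ℝ≥0∞ :=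
  ∑' z, ω.cond x z

/-- The volume `m^ω(B) = ∑_{x ∈ B} m^ω(x)`. -/
noncomputable def vol (ω : Environment d) (B : Set (Fin d → ℤ)) : ℝ≥0∞ :=
  ∑' x : B, ω.mass x

theorem finite_neighborSet (x : Fin d → ℤ) : ((latticeGraph d).neighborSet x).Finite := by
  refine (Set.finite_Icc (x - 1) (x + 1)).subset fun y hy => ?_
  have hy' : ∑ i, |x i - y i| = 1 := hy
  have key : ∀ i, |x i - y i| ≤ 1 := fun i => hy' ▸
    Finset.single_le_sum (f := fun i => |x i - y i|) (fun j _ => abs_nonneg _) (Finset.mem_univ i)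
  constructor <;> intro i <;> have := abs_le.1 (key i) <;>
    simp only [Pi.sub_apply, Pi.add_apply, Pi.one_apply] <;> omega

theorem mass_ne_top (ω : Environment d) (x : Fin d → ℤ) : ω.mass x ≠ ∞ := by
  have h : ∀ z ∉ (finite_neighborSet x).toFinset, ω.cond x z = 0 := fun z hz => by
    have hz' : ¬ (latticeGraph d).Adj x z := by simpa using hz
    simp [cond, hz']
  rw [mass, tsum_eq_sum h]
  refine ENNReal.sum_ne_top.2 fun z _ => ?_
  unfold cond
  split_ifs <;> simp

open Classical in
/-- One step of the walk: from `x` go to `y` with probability `p^ω(x, y) = ω(x, y) / m^ω(x)`.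
At a point all of whose edges have conductance `0`, where this is undefined, the walk stays. -/
noncomputable def step (ω : Environment d) (x : Fin d → ℤ) : PMF (Fin d → ℤ) :=
  if h : ω.mass x = 0 then PMF.pure x else PMF.normalize (ω.cond x) h (ω.mass_ne_top x)

/-- The transition kernel `p^ω`. -/
noncomputable def stepKernel (ω : Environment d) : Kernel (Fin d → ℤ) (Fin d → ℤ) :=
  Kernel.ofFunOfCountable fun x => (ω.step x).toMeasure

instance (ω : Environment d) : IsMarkovKernel ω.stepKernel :=
  ⟨fun x => inferInstanceAs (IsProbabilityMeasure (ω.step x).toMeasure)⟩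

/-- The transition kernel at time `n` given the whole past `X_0, …, X_n`; it depends only
on `X_n`. -/
noncomputable def pastKernel (ω : Environment d) (n : ℕ) :
    Kernel ((_ : Finset.Iic n) → Fin d → ℤ) (Fin d → ℤ) :=
  ω.stepKernel.comap (fun X => X ⟨n, Finset.mem_Iic.2 le_rfl⟩) (measurable_pi_apply _)

instance (ω : Environment d) (n : ℕ) : IsMarkovKernel (ω.pastKernel n) :=
  inferInstanceAs (IsMarkovKernel (ω.stepKernel.comap _ _))

/-- The law `P_x^ω` of the walk `(X_n)_{n ≥ 0}` started at `x`. -/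
noncomputable def walkLaw (ω : Environment d) (x : Fin d → ℤ) : Measure (ℕ → Fin d → ℤ) :=
  Kernel.traj (X := fun _ => Fin d → ℤ) ω.pastKernel 0 (fun _ => x)

end Environment

/-- The occupation time `l_B = card {k ∈ ℕ ; X_k ∈ B}` of a trajectory. -/
noncomputable def occupationTime {d : ℕ} (B : Set (Fin d → ℤ)) (X : ℕ → Fin d → ℤ) : ℕ∞ :=
  {k : ℕ | X k ∈ B}.encard

/-! The expected occupation time of B is the sum over y ∈ B of m(y) u(y), where u is the Green
density of the walk from 0 with respect to the reversible measure. Truncated at a finite time, u is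
a finitely supported potential on the network of conductances, with a unit source at 0 and otherwise
only sinks. Everything rests on bounding |{u > s}| by a multiple of s^(-d/(d-2)) once this set is
large, with a factor that does not depend on ω.

Conductances may be arbitrarily small, so isoperimetry is needed for strong edges only (conductance
at least ξ). By the maximum principle the sets {u > s} are linked to 0. A linked set A has an outer
contour S with |A|^(d-1) ≤ |S|^d, connected through near edges (`IsLinked.exists_contour`), and the
number of candidates of size m is exponential in m. A Peierls argument then works: for small ξ,
Borel–Cantelli shows that almost surely no large contour has half of its edges weak
(`ae_exists_strong_isoperimetry`).

Now let {u > s} have n points, hence at least n^(1-1/d)/2 strong boundary edges. The total current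
through its boundary is at most 1, so most of these edges have a small potential drop. Lowering s by
a multiple of n^(1/d-1) therefore adds a multiple of n^(1-1/d) points
(`IsSubpotential.card_superlevel_sub`). Iterating down to height 0 gives s ≤ K n^(2/d-1)
(`IsSubpotential.height_le`); the exponent is negative because d ≥ 3.

Since m is bounded above but not below, B may have far more points than mass. In
`IsSubpotential.sum_mul_le_rpow`, B of mass V is therefore cut at a height of order V^(2/d-1): the
part below contributes at most V times this height, the part above has at most about V points and is
handled by rearrangement. The finitely many points where the isoperimetry is not yet available cost
a finite amount depending on ω (`IsSubpotential.le_of_strongIsoperimetry`), absorbed by taking V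
large. -/

/-! ### Isoperimetry in the lattice -/

/-- Discrete isoperimetric inequality: if every axis-parallel line through a point of `A` meets the
family `S` of directed edges in its own direction, then `|A|^(d-1) ≤ |S|^d`. -/
theorem card_pow_le_card_pow_of_lines {d : ℕ} (hd : 2 ≤ d) (A : Finset (Fin d → ℤ))
    (S : Finset ((Fin d → ℤ) × Fin d))
    (h : ∀ x ∈ A, ∀ i, ∃ t : ℤ, (Function.update x i t, i) ∈ S) :
    A.card ^ (d - 1) ≤ S.card ^ d := by
  classical
  have hd1 : (1 : ℝ) < d := by exact_mod_cast hd
  have hp : (Fintype.card (Fin d) : ℝ).HolderConjugate ((d : ℝ) / (d - 1)) := by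
    rw [Real.holderConjugate_iff, Fintype.card_fin]
    refine ⟨hd1, ?_⟩
    have : (d : ℝ) - 1 ≠ 0 := by linarith
    field_simp
    ring
  let f : (Fin d → ℤ) → ℝ≥0∞ := fun x => ∑ i, if (x, i) ∈ S then 1 else 0
  have hpi : (Measure.pi fun _ : Fin d => (Measure.count : Measure ℤ)) = Measure.count := by
    apply Measure.ext_of_singleton
    intro x
    rw [Measure.pi_singleton]; simp
  -- The Gagliardo–Loomis–Whitney inequality for counting measure; at a point of `A` each of the d
  -- line integrals of `f` is at least 1.
  have key := lintegral_prod_lintegral_pow_le (fun _ : Fin d => (Measure.count : Measure ℤ)) hp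
    (f := f) (measurable_of_countable f)
  rw [hpi, lintegral_count, lintegral_count] at key
  have hf : ∑' x, f x = S.card := by
    simp only [f]
    rw [Summable.tsum_finsetSum (fun _ _ => ENNReal.summable)]
    have : ∀ i : Fin d, ∑' x, (if (x, i) ∈ S then (1 : ℝ≥0∞) else 0)
        = ((S.filter fun p => p.2 = i).card : ℝ≥0∞) := fun i => by
      rw [tsum_eq_sum (s := (S.filter fun p => p.2 = i).image Prod.fst)]
      · rw [Finset.sum_image]
        · rw [Finset.sum_congr rfl (g := fun _ => (1 : ℝ≥0∞))]
          · simp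
          · rintro ⟨x, j⟩ hx
            simp only [Finset.mem_filter] at hx
            simp [← hx.2, hx.1]
        · rintro ⟨x, j⟩ hx ⟨y, k⟩ hy hxy
          simp_all
      · intro x hx
        rw [if_neg]
        intro hxi
        exact hx (Finset.mem_image.2 ⟨(x, i), by simp [hxi], rfl⟩)
    simp_rw [this]
    rw [← Nat.cast_sum, ← Finset.card_eq_sum_card_fiberwise (fun _ _ => Finset.mem_coe.2 (Finset.mem_univ _))]
  have hA : (A.card : ℝ≥0∞) ≤ ∑' x, ∏ i, (∫⁻ t, f (Function.update x i t) ∂Measure.count) ^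
      ((1 : ℝ) / ((Fintype.card (Fin d) : ℝ) - 1)) := by
    refine le_trans ?_ (ENNReal.sum_le_tsum A)
    rw [Finset.card_eq_sum_ones, Nat.cast_sum]
    refine Finset.sum_le_sum fun x hx => ?_
    rw [Nat.cast_one]
    refine le_of_eq_of_le Finset.prod_const_one.symm (Finset.prod_le_prod' fun i _ => ?_)
    refine ENNReal.one_le_rpow ?_ ?_
    · rw [lintegral_count]
      obtain ⟨t, ht⟩ := h x hx i
      refine le_trans ?_ (ENNReal.le_tsum t)
      refine le_trans ?_ (Finset.single_le_sum (fun _ _ => zero_le) (Finset.mem_univ i))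
      simp [ht]
    · rw [Fintype.card_fin]
      have : 0 < (d : ℝ) - 1 := by linarith
      positivity
  have h1 := hA.trans key
  rw [hf] at h1
  have h2 : ((A.card : ℝ≥0∞)) ^ ((d : ℝ) - 1) ≤ (S.card : ℝ≥0∞) ^ (d : ℝ) := by
    have h3 := ENNReal.rpow_le_rpow h1 (by linarith : 0 ≤ (d : ℝ) - 1)
    rw [← ENNReal.rpow_mul, div_mul_cancel₀ _ (by linarith)] at h3
    exact h3
  have h4 : ((d : ℝ) - 1) = ((d - 1 : ℕ) : ℝ) := by
    rw [Nat.cast_sub (by omega)]; simp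
  rw [h4, ENNReal.rpow_natCast, ENNReal.rpow_natCast] at h2
  exact_mod_cast h2

/-! ### Outer contours as cocycles modulo 2 -/

/-- The unit vector in direction `i`. The pair `(x, i)` encodes the edge `{x, x + unitVec i}`. -/
abbrev unitVec {d : ℕ} (i : Fin d) : Fin d → ℤ := Pi.single i 1

/-- The lattice edges with exactly one endpoint in `A`. -/
def edgeBoundary {d : ℕ} (A : Finset (Fin d → ℤ)) : Finset ((Fin d → ℤ) × Fin d) :=
  ((A ∪ A.biUnion fun y => Finset.univ.image fun i => y - unitVec i) ×ˢ Finset.univ).filter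
    fun p => ¬ (p.1 ∈ A ↔ p.1 + unitVec p.2 ∈ A)

theorem mem_edgeBoundary {d : ℕ} {A : Finset (Fin d → ℤ)} {p : (Fin d → ℤ) × Fin d} :
    p ∈ edgeBoundary A ↔ ¬ (p.1 ∈ A ↔ p.1 + unitVec p.2 ∈ A) := by
  obtain ⟨x, i⟩ := p
  simp only [edgeBoundary, Finset.mem_filter, Finset.mem_product, Finset.mem_univ, and_true,
    Finset.mem_union, Finset.mem_biUnion, Finset.mem_image, true_and, and_iff_right_iff_imp]
  intro h
  by_cases hx : x ∈ A
  · exact Or.inl hx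
  · refine Or.inr ⟨x + unitVec i, ?_, i, by simp⟩
    by_contra h'
    exact h (by simp [hx, h'])

/-- `A` contains `0` and no proper part of `A` containing `0` is separated from the rest. -/
def IsLinked {d : ℕ} (A : Finset (Fin d → ℤ)) : Prop :=
  0 ∈ A ∧ ∀ K ⊆ A, 0 ∈ K →
    (∀ x i, x ∈ A → x + unitVec i ∈ A → (x ∈ K ↔ x + unitVec i ∈ K)) → K = A

/-- The indicator of a family of edges, as a cochain modulo `2`. -/
def edgeChain {d : ℕ} (S : Finset ((Fin d → ℤ) × Fin d)) (p : (Fin d → ℤ) × Fin d) : ZMod 2 :=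
  if p ∈ S then 1 else 0

/-- `S` contains an even number of edges of each unit square. -/
def IsCocycle {d : ℕ} (S : Finset ((Fin d → ℤ) × Fin d)) : Prop :=
  ∀ x i j, edgeChain S (x, i) + edgeChain S (x + unitVec i, j) =
    edgeChain S (x, j) + edgeChain S (x + unitVec j, i)

/-- The parity of the number of edges of `S` on the ray of length `R` from `x` in direction `i`. -/
def rayParity {d : ℕ} (i : Fin d) (R : ℕ) (S : Finset ((Fin d → ℤ) × Fin d)) (x : Fin d → ℤ) :
    ZMod 2 :=
  ∑ k ∈ Finset.range R, edgeChain S (x + Pi.single i (k : ℤ), i)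

theorem edgeChain_edgeBoundary {d : ℕ} (A : Finset (Fin d → ℤ)) (x : Fin d → ℤ) (i : Fin d) :
    edgeChain (edgeBoundary A) (x, i) =
      (if x ∈ A then 1 else 0) + (if x + unitVec i ∈ A then 1 else 0) := by
  simp only [edgeChain, mem_edgeBoundary]
  have h2 : (1 : ZMod 2) + 1 = 0 := rfl
  by_cases h : x ∈ A <;> by_cases h' : x + unitVec i ∈ A <;> simp [h, h', h2]

/-- The chain is the coboundary of the indicator of `A`, and a coboundary has zero coboundary. -/
theorem isCocycle_edgeBoundary {d : ℕ} (A : Finset (Fin d → ℤ)) :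
    IsCocycle (edgeBoundary A) := by
  intro x i j
  simp only [edgeChain_edgeBoundary]
  rw [add_right_comm x (unitVec j)]
  linear_combination CharTwo.add_self_eq_zero (if x + unitVec i ∈ A then (1 : ZMod 2) else 0) -
    CharTwo.add_self_eq_zero (if x + unitVec j ∈ A then (1 : ZMod 2) else 0)

theorem rayParity_edgeBoundary {d : ℕ} (A : Finset (Fin d → ℤ)) (i : Fin d) (R : ℕ)
    (x : Fin d → ℤ) : rayParity i R (edgeBoundary A) x =
      (if x ∈ A then 1 else 0) + (if x + Pi.single i (R : ℤ) ∈ A then 1 else 0) := by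
  induction R with
  | zero => simp [rayParity, CharTwo.add_self_eq_zero]
  | succ R ih =>
    rw [rayParity, Finset.sum_range_succ, ← rayParity, ih, edgeChain_edgeBoundary]
    have : x + Pi.single i (R : ℤ) + unitVec i = x + Pi.single i ((R + 1 : ℕ) : ℤ) := by
      push_cast; rw [Pi.single_add, add_assoc]
    rw [this]
    linear_combination CharTwo.add_self_eq_zero
      (if x + Pi.single i (R : ℤ) ∈ A then (1 : ZMod 2) else 0)

/-- Stokes on the strip of squares between two adjacent parallel rays: only the two end rungs
survive. -/
theorem IsCocycle.rayParity_add {d : ℕ} {S : Finset ((Fin d → ℤ) × Fin d)} (hS : IsCocycle S)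
    (i j : Fin d) (R : ℕ) (x : Fin d → ℤ) :
    rayParity i R S (x + unitVec j) =
      rayParity i R S x + edgeChain S (x, j) + edgeChain S (x + Pi.single i (R : ℤ), j) := by
  induction R with
  | zero => simp [rayParity, CharTwo.add_self_eq_zero]
  | succ R ih =>
    rw [rayParity, Finset.sum_range_succ, ← rayParity, ih, rayParity, rayParity,
      Finset.sum_range_succ]
    have h1 : x + Pi.single i (R : ℤ) + unitVec i = x + Pi.single i ((R + 1 : ℕ) : ℤ) := by
      push_cast; rw [Pi.single_add, add_assoc]
    have h2 := hS (x + Pi.single i (R : ℤ)) j i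
    rw [h1] at h2
    rw [add_right_comm x (unitVec j)]
    linear_combination h2

/-- Two edges are near each other if their base points are equal or diagonal neighbours. -/
def EdgeNear {d : ℕ} (p q : (Fin d → ℤ) × Fin d) : Prop := ∀ j, |p.1 j - q.1 j| ≤ 1

/-- The edges of a unit square are pairwise near, so on each square `T` either agrees with `S` or is
absent. -/
theorem IsCocycle.of_separated {d : ℕ} {S T : Finset ((Fin d → ℤ) × Fin d)} (hS : IsCocycle S)
    (hTS : T ⊆ S) (hT : ∀ p ∈ T, ∀ q ∈ S, q ∉ T → ¬ EdgeNear p q) : IsCocycle T := by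
  have hu : ∀ (i j : Fin d), 0 ≤ unitVec i j ∧ unitVec i j ≤ 1 := fun i j => by
    rcases eq_or_ne j i with rfl | h
    · simp
    · simp [h]
  have near : ∀ (z : Fin d → ℤ) (p q : (Fin d → ℤ) × Fin d),
      (∀ k, z k ≤ p.1 k ∧ p.1 k ≤ z k + 1) → (∀ k, z k ≤ q.1 k ∧ q.1 k ≤ z k + 1) →
      EdgeNear p q := fun z p q hp hq k => by
    have := hp k; have := hq k
    rw [abs_le]; omega
  intro x i j
  let sq : Set ((Fin d → ℤ) × Fin d) := {p | ∀ k, x k ≤ p.1 k ∧ p.1 k ≤ x k + 1}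
  have m1 : ∀ k, (x, k) ∈ sq := fun k l => by simp
  have m2 : ∀ k l, (x + unitVec k, l) ∈ sq := fun k l m => by
    simp only [Pi.add_apply]; have := hu k m; omega
  by_cases hex : ∃ p ∈ T, p ∈ sq
  · obtain ⟨p, hpT, hp⟩ := hex
    have hc : ∀ q ∈ sq, edgeChain T q = edgeChain S q := fun q hq => by
      unfold edgeChain
      have : q ∈ T ↔ q ∈ S := ⟨fun h => hTS h, fun h => by
        by_contra h'
        exact hT p hpT q h h' (near x p q hp hq)⟩
      simp [this]
    rw [hc _ (m1 _), hc _ (m1 _), hc _ (m2 _ _), hc _ (m2 _ _)]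
    exact hS x i j
  · have hc : ∀ q ∈ sq, edgeChain T q = 0 := fun q hq => by
      unfold edgeChain
      rw [if_neg]
      exact fun h => hex ⟨q, h, hq⟩
    rw [hc _ (m1 _), hc _ (m1 _), hc _ (m2 _ _), hc _ (m2 _ _)]

theorem rayParity_sdiff {d : ℕ} {S T : Finset ((Fin d → ℤ) × Fin d)} (hTS : T ⊆ S) (i : Fin d)
    (R : ℕ) (x : Fin d → ℤ) :
    rayParity i R S x = rayParity i R T x + rayParity i R (S \ T) x := by
  unfold rayParity
  rw [← Finset.sum_add_distrib]
  refine Finset.sum_congr rfl fun k _ => ?_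
  unfold edgeChain
  by_cases h : (x + Pi.single i (k : ℤ), i) ∈ T
  · simp [h, hTS h]
  · simp [h]

theorem exists_mem_of_rayParity_ne_zero {d : ℕ} {S : Finset ((Fin d → ℤ) × Fin d)} {i : Fin d}
    {R : ℕ} {x : Fin d → ℤ} (h : rayParity i R S x ≠ 0) :
    ∃ k : ℕ, (x + Pi.single i (k : ℤ), i) ∈ S := by
  obtain ⟨k, -, hk⟩ := Finset.exists_ne_zero_of_sum_ne_zero h
  refine ⟨k, ?_⟩
  by_contra hc
  exact hk (by simp [edgeChain, hc])

/-- The outer contour of a finite linked set: a part `S` of its edge boundary which cannot be split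
into two pieces far from each other, and which meets every ray issued from a point of the set. -/
theorem IsLinked.exists_contour {d : ℕ} (i₀ : Fin d) {A : Finset (Fin d → ℤ)} (hA : IsLinked A) :
    ∃ S ⊆ edgeBoundary A, (∀ x ∈ A, ∀ i, ∃ k : ℕ, (x + Pi.single i (k : ℤ), i) ∈ S) ∧
      ∀ T ⊆ S, T.Nonempty → (∀ p ∈ T, ∀ q ∈ S, q ∉ T → ¬ EdgeNear p q) → T = S := by
  classical
  -- Rays of length `R` issued from `A` leave both `A` and its boundary, so their far ends never
  -- contribute.
  obtain ⟨R, hR1, hR2⟩ : ∃ R : ℕ, (∀ p ∈ edgeBoundary A, ∀ x ∈ A, ∀ j, p.1 j < x j + R) ∧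
      (∀ y ∈ A, ∀ x ∈ A, ∀ j, y j < x j + R) := by
    have hev : ∀ c : ℤ, ∀ᶠ R : ℕ in Filter.atTop, c < R := fun c =>
      tendsto_natCast_atTop_atTop.eventually_gt_atTop c
    have h1 : ∀ᶠ R : ℕ in Filter.atTop, ∀ p ∈ edgeBoundary A, ∀ x ∈ A, ∀ j, p.1 j < x j + R := by
      simp only [Filter.eventually_all_finset, Filter.eventually_all]
      intro p _ x _ j
      filter_upwards [hev (p.1 j - x j)] with R hR
      omega
    have h2 : ∀ᶠ R : ℕ in Filter.atTop, ∀ y ∈ A, ∀ x ∈ A, ∀ j, y j < x j + R := by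
      simp only [Filter.eventually_all_finset, Filter.eventually_all]
      intro y _ x _ j
      filter_upwards [hev (y j - x j)] with R hR
      omega
    exact (h1.and h2).exists
  -- The contour is a smallest cocycle inside the boundary which the ray from 0 crosses an odd
  -- number of times.
  let good : Finset (Finset ((Fin d → ℤ) × Fin d)) :=
    (edgeBoundary A).powerset.filter fun S => IsCocycle S ∧ rayParity i₀ R S 0 = 1
  have hgood : good.Nonempty := by
    refine ⟨edgeBoundary A, ?_⟩
    simp only [good, Finset.mem_filter, Finset.mem_powerset, subset_refl, true_and]
    refine ⟨isCocycle_edgeBoundary A, ?_⟩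
    rw [rayParity_edgeBoundary, if_pos hA.1, if_neg, add_zero]
    intro h
    simpa using hR2 _ h 0 hA.1 i₀
  obtain ⟨S, hSg, hmin⟩ := Finset.exists_min_image good Finset.card hgood
  simp only [good, Finset.mem_filter, Finset.mem_powerset] at hSg
  obtain ⟨hSA, hSc, hS1⟩ := hSg
  have far : ∀ x ∈ A, ∀ (z : Fin d → ℤ) (j i : Fin d), x j + R ≤ z j →
      edgeChain S (z, i) = 0 := fun x hx z j i hz => by
    unfold edgeChain
    rw [if_neg]
    intro h
    have := hR1 _ (hSA h) x hx j
    simp only at this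
    omega
  -- The parity changes only across an edge of `S`, and no such edge joins two points of `A`;
  -- linkedness carries the value from 0 to all of `A`.
  have hone : ∀ x ∈ A, rayParity i₀ R S x = 1 := by
    have := hA.2 (A.filter fun x => rayParity i₀ R S x = 1) (Finset.filter_subset _ _)
      (by simp [hA.1, hS1]) fun x i hx hxi => by
        simp only [Finset.mem_filter, hx, hxi, true_and]
        have hfar : edgeChain S (x + Pi.single i₀ (R : ℤ), i) = 0 := by
          refine far x hx _ i₀ i ?_
          simp
        rw [hSc.rayParity_add, hfar]
        have : edgeChain S (x, i) = 0 := by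
          unfold edgeChain
          rw [if_neg]
          intro h
          exact mem_edgeBoundary.1 (hSA h) (by simp [hx, hxi])
        simp [this]
    intro x hx
    rw [← this] at hx
    exact (Finset.mem_filter.1 hx).2
  refine ⟨S, hSA, ?_, ?_⟩
  · intro x hx i
    by_cases hi : i = i₀
    · subst hi
      exact exists_mem_of_rayParity_ne_zero (R := R) (by rw [hone x hx]; exact one_ne_zero)
    · by_contra hc
      push Not at hc
      -- If the ray in direction `i` missed `S`, odd parity would be transported along it beyond the
      -- reach of `S`, where the parity is 0.
      have hk : ∀ k : ℕ, rayParity i₀ R S (x + Pi.single i (k : ℤ)) = 1 := fun k => by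
        induction k with
        | zero => simpa using hone x hx
        | succ k ih =>
          have : x + Pi.single i ((k + 1 : ℕ) : ℤ) = x + Pi.single i (k : ℤ) + unitVec i := by
            push_cast; rw [Pi.single_add, add_assoc]
          have hfar : edgeChain S (x + Pi.single i (k : ℤ) + Pi.single i₀ (R : ℤ), i) = 0 := by
            refine far x hx _ i₀ i ?_
            simp [Ne.symm hi]
          rw [this, hSc.rayParity_add, ih, hfar]
          simp [edgeChain, hc k]
      have := hk R
      rw [rayParity, Finset.sum_eq_zero] at this
      · exact zero_ne_one this
      · intro k _
        refine far x hx _ i i₀ ?_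
        simp [hi]
  · intro T hTS hT hsep
    by_contra hne
    have hTc := hSc.of_separated hTS hsep
    have hTc' : IsCocycle (S \ T) := by
      refine hSc.of_separated Finset.sdiff_subset fun p hp q hq hqT hpq => ?_
      simp only [Finset.mem_sdiff, hq, true_and, not_not] at hp hqT
      exact hsep q hqT p hp.1 hp.2 fun j => by rw [abs_sub_comm]; exact hpq j
    have hcard : T.card < S.card :=
      Finset.card_lt_card (hTS.ssubset_of_ne hne)
    have hcard' : (S \ T).card < S.card := by
      rw [Finset.card_sdiff_of_subset hTS]
      have := hT.card_pos
      omega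
    -- One of two far pieces would be crossed an odd number of times and, being a smaller cocycle,
    -- contradict minimality.
    have hsum := rayParity_sdiff hTS i₀ R 0
    rw [hS1] at hsum
    have hz : ∀ a b : ZMod 2, 1 = a + b → a = 1 ∨ b = 1 := by decide
    rcases hz _ _ hsum with h | h
    · have := hmin T (by
        simp only [good, Finset.mem_filter, Finset.mem_powerset]
        exact ⟨hTS.trans hSA, hTc, h⟩)
      omega
    · have := hmin (S \ T) (by
        simp only [good, Finset.mem_filter, Finset.mem_powerset]
        exact ⟨Finset.sdiff_subset.trans hSA, hTc', h⟩)
      omega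

/-! ### Counting contours -/

/-- The edges near a given edge. -/
noncomputable def edgeNeighbors {d : ℕ} (p : (Fin d → ℤ) × Fin d) : Finset ((Fin d → ℤ) × Fin d) :=
  Finset.Icc (p.1 - 1) (p.1 + 1) ×ˢ Finset.univ

theorem mem_edgeNeighbors {d : ℕ} {p q : (Fin d → ℤ) × Fin d} :
    q ∈ edgeNeighbors p ↔ EdgeNear p q := by
  simp only [edgeNeighbors, Finset.mem_product, Finset.mem_Icc, Finset.mem_univ, and_true,
    EdgeNear, Pi.le_def, Pi.sub_apply, Pi.add_apply, Pi.one_apply, ← forall_and]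
  refine forall_congr' fun j => ?_
  rw [abs_le]
  omega

theorem card_edgeNeighbors {d : ℕ} (p : (Fin d → ℤ) × Fin d) :
    (edgeNeighbors p).card = 3 ^ d * d := by
  have : ∀ i, p.1 i + 1 + 1 - (p.1 i - 1) = 3 := fun i => by ring
  simp [edgeNeighbors, Finset.card_product, Pi.card_Icc, this]

/-- The ranges of the paths of `n` steps started at `p`, for steps between near edges. -/
noncomputable def pathRanges {d : ℕ} : ℕ → (Fin d → ℤ) × Fin d → Finset (Finset ((Fin d → ℤ) × Fin d))
  | 0, p => {{p}}
  | n + 1, p => (edgeNeighbors p).biUnion fun q => (pathRanges n q).image (insert p)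

theorem card_pathRanges_le {d : ℕ} (n : ℕ) (p : (Fin d → ℤ) × Fin d) :
    (pathRanges n p).card ≤ (3 ^ d * d) ^ n := by
  induction n generalizing p with
  | zero => simp [pathRanges]
  | succ n ih =>
    rw [pathRanges, pow_succ', ← card_edgeNeighbors p]
    exact Finset.card_biUnion_le_card_mul _ _ _ fun q _ =>
      Finset.card_image_le.trans (card_edgeNeighbors p ▸ ih q)

theorem abs_sub_le_of_mem_pathRanges {d : ℕ} {n : ℕ} {p q : (Fin d → ℤ) × Fin d}
    {T : Finset ((Fin d → ℤ) × Fin d)} (hT : T ∈ pathRanges n p) (hq : q ∈ T) (j : Fin d) :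
    |p.1 j - q.1 j| ≤ n := by
  induction n generalizing p T with
  | zero =>
    simp only [pathRanges, Finset.mem_singleton] at hT
    subst hT
    simp [Finset.mem_singleton.1 hq]
  | succ n ih =>
    simp only [pathRanges, Finset.mem_biUnion, Finset.mem_image] at hT
    obtain ⟨r, hr, T', hT', rfl⟩ := hT
    rcases Finset.mem_insert.1 hq with rfl | h
    · simp; positivity
    · have h1 := ih hT' h
      have h2 := mem_edgeNeighbors.1 hr j
      push_cast
      have := abs_sub_le (p.1 j) (r.1 j) (q.1 j)
      omega

/-- The graph of near edges. -/
def nearGraph (d : ℕ) : SimpleGraph ((Fin d → ℤ) × Fin d) where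
  Adj p q := p ≠ q ∧ EdgeNear p q
  symm := ⟨fun _ _ h => ⟨h.1.symm, fun j => by rw [abs_sub_comm]; exact h.2 j⟩⟩
  loopless := ⟨fun _ h => h.1 rfl⟩

theorem support_mem_pathRanges {d : ℕ} {p q : (Fin d → ℤ) × Fin d} (w : (nearGraph d).Walk p q) :
    w.support.toFinset ∈ pathRanges w.length p := by
  induction w with
  | nil => simp [pathRanges]
  | cons h w ih =>
    simp only [SimpleGraph.Walk.support_cons, List.toFinset_cons, SimpleGraph.Walk.length_cons,
      pathRanges, Finset.mem_biUnion, Finset.mem_image]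
    exact ⟨_, mem_edgeNeighbors.2 h.2, _, ih, rfl⟩

/-- A finite set which does not split into far pieces is the range of a path of length
`2 (|S| - 1)` started at any of its points. -/
theorem mem_pathRanges_of_not_separated {d : ℕ} {S : Finset ((Fin d → ℤ) × Fin d)}
    (hS : ∀ T ⊆ S, T.Nonempty → (∀ p ∈ T, ∀ q ∈ S, q ∉ T → ¬ EdgeNear p q) → T = S)
    {p : (Fin d → ℤ) × Fin d} (hp : p ∈ S) : S ∈ pathRanges (2 * (S.card - 1)) p := by
  have key : ∀ k, k + 1 ≤ S.card → ∃ w : (nearGraph d).Walk p p,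
      w.support.toFinset ⊆ S ∧ w.support.toFinset.card = k + 1 ∧ w.length = 2 * k := by
    intro k
    induction k with
    | zero => exact fun _ => ⟨.nil, by simp [hp], by simp, rfl⟩
    | succ k ih =>
      intro hk
      obtain ⟨w, hwS, hwc, hwl⟩ := ih (by omega)
      have hne : w.support.toFinset ≠ S := fun h => by rw [h] at hwc; omega
      obtain ⟨u, hu, q, hq, hqw, hnear⟩ : ∃ u ∈ w.support.toFinset, ∃ q ∈ S,
          q ∉ w.support.toFinset ∧ EdgeNear u q := by
        by_contra hc
        push Not at hc
        exact hne (hS _ hwS ⟨p, by simp⟩ hc)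
      have huw : u ∈ w.support := List.mem_toFinset.1 hu
      have hadj : (nearGraph d).Adj u q := ⟨fun h => hqw (h ▸ hu), hnear⟩
      -- A detour from `u` to the new edge `q` and back: the walk stays closed and each new vertex
      -- costs two steps.
      let w' := (w.takeUntil u huw).append (.cons hadj (.cons hadj.symm (w.dropUntil u huw)))
      have hsup : w'.support.toFinset = insert q w.support.toFinset := by
        ext r
        simp only [w', List.mem_toFinset, SimpleGraph.Walk.mem_support_append_iff,
          SimpleGraph.Walk.support_cons, List.mem_cons, Finset.mem_insert]
        have h1 : r ∈ w.support ↔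
            r ∈ (w.takeUntil u huw).support ∨ r ∈ (w.dropUntil u huw).support := by
          conv_lhs => rw [← w.take_spec huw]
          exact SimpleGraph.Walk.mem_support_append_iff _ _
        have h2 : u ∈ (w.takeUntil u huw).support := SimpleGraph.Walk.end_mem_support _
        rw [h1]
        constructor
        · rintro (h | rfl | h | h)
          exacts [.inr (.inl h), .inr (.inl h2), .inl h, .inr (.inr h)]
        · rintro (h | h | h)
          exacts [.inr (.inr (.inl h)), .inl h, .inr (.inr (.inr h))]
      refine ⟨w', ?_, ?_, ?_⟩
      · rw [hsup]
        exact Finset.insert_subset hq hwS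
      · rw [hsup, Finset.card_insert_of_notMem hqw, hwc]
      · have h1 := congrArg SimpleGraph.Walk.length (w.take_spec huw)
        rw [SimpleGraph.Walk.length_append] at h1
        simp only [w', SimpleGraph.Walk.length_append, SimpleGraph.Walk.length_cons]
        omega
  have hpos : 0 < S.card := Finset.card_pos.2 ⟨p, hp⟩
  obtain ⟨w, hwS, hwc, hwl⟩ := key (S.card - 1) (by omega)
  have : w.support.toFinset = S := Finset.eq_of_subset_of_card_le hwS (by omega)
  rw [← hwl, ← this]
  exact support_mem_pathRanges w

/-- A linked set has an outer contour of isoperimetric size, which is one of the ranges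
enumerated by `pathRanges`. -/
theorem IsLinked.exists_pathRange {d : ℕ} {i₀ i₁ : Fin d} (hi : i₀ ≠ i₁)
    {A : Finset (Fin d → ℤ)} (hA : IsLinked A) :
    ∃ S ⊆ edgeBoundary A, A.card ^ (d - 1) ≤ S.card ^ d ∧ ∃ k ≤ 2 * S.card,
      S ∈ pathRanges (2 * (S.card - 1)) (Pi.single i₀ (k : ℤ), i₀) := by
  obtain ⟨S, hSA, hray, hsep⟩ := hA.exists_contour i₀
  have hd : 2 ≤ d := by
    have h0 := i₀.2
    have h1 := i₁.2
    have : (i₀ : ℕ) ≠ i₁ := fun h => hi (Fin.ext h)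
    omega
  obtain ⟨k, hk⟩ := hray 0 hA.1 i₀
  obtain ⟨l, hl⟩ := hray 0 hA.1 i₁
  rw [zero_add] at hk hl
  have hpath := mem_pathRanges_of_not_separated hsep hk
  refine ⟨S, hSA, ?_, k, ?_, hpath⟩
  · refine card_pow_le_card_pow_of_lines hd A S fun x hx i => ?_
    obtain ⟨k, hk⟩ := hray x hx i
    refine ⟨x i + k, ?_⟩
    convert hk using 2
    ext j
    rcases eq_or_ne j i with rfl | h
    · simp
    · simp [h]
  -- The contour also meets the `i₁`-axis, whose points have `i₀`-coordinate 0, so its diameter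
  -- bounds `k`.
  · have := abs_sub_le_of_mem_pathRanges hpath hl i₀
    simp only [Pi.single_eq_same, ne_eq, hi, not_false_eq_true, Pi.single_eq_of_ne, sub_zero,
      Nat.abs_cast] at this
    omega

/-! ### Peierls argument for the random conductances -/

theorem latticeGraph_adj_add {d : ℕ} (x : Fin d → ℤ) (i : Fin d) :
    (latticeGraph d).Adj x (x + unitVec i) := by
  change ∑ j, |x j - (x + unitVec i) j| = 1
  rw [Finset.sum_eq_single i]
  · simp
  · intro j _ hj
    simp [hj]
  · simp

/-- The lattice edge encoded by a pair. -/
def latticeEdge {d : ℕ} (p : (Fin d → ℤ) × Fin d) : (latticeGraph d).edgeSet :=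
  ⟨s(p.1, p.1 + unitVec p.2), latticeGraph_adj_add p.1 p.2⟩

theorem latticeEdge_injective {d : ℕ} : Function.Injective (latticeEdge (d := d)) := by
  rintro ⟨x, i⟩ ⟨y, j⟩ h
  have h' : s(x, x + unitVec i) = s(y, y + unitVec j) := congrArg Subtype.val h
  have inj : ∀ k : Fin d, unitVec i = unitVec k → i = k := fun k hk => by
    by_contra hne
    have := congrFun hk i
    simp [hne] at this
  rcases Sym2.eq_iff.1 h' with ⟨h1, h2⟩ | ⟨h1, h2⟩
  · subst h1
    rw [inj j (add_left_cancel h2)]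
  · exfalso
    subst h1
    have h3 : unitVec j + unitVec i = 0 := by
      rw [add_assoc] at h2
      simpa using h2
    have h4 := congrFun h3 i
    simp only [Pi.add_apply, Pi.single_eq_same, Pi.zero_apply] at h4
    have : 0 ≤ unitVec j i := by
      rcases eq_or_ne i j with rfl | h
      · simp
      · simp [h]
    omega

theorem iidLaw_forall_lt {d : ℕ} (ν : Measure ℝ≥0) [IsProbabilityMeasure ν] (ξ : ℝ≥0)
    (T : Finset ((Fin d → ℤ) × Fin d)) :
    iidLaw d ν {ω | ∀ p ∈ T, ω (latticeEdge p) < ξ} = ν (Set.Iio ξ) ^ T.card := by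
  classical
  have : {ω : Environment d | ∀ p ∈ T, ω (latticeEdge p) < ξ} =
      ((T.image latticeEdge : Finset _) : Set (latticeGraph d).edgeSet).pi
        fun _ => Set.Iio ξ := by
    ext ω
    simp only [Set.mem_pi, Finset.coe_image, Set.forall_mem_image]
    rfl
  rw [this, iidLaw, Measure.infinitePi_pi _ (fun _ _ => measurableSet_Iio), Finset.prod_const,
    Finset.card_image_of_injective _ latticeEdge_injective]

/-- Continuity from above along the intervals [0, 1/(n+1)), whose intersection {0} is null. -/
theorem exists_measure_Iio_le (ν : Measure ℝ≥0) [IsProbabilityMeasure ν]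
    (hpos : ∀ᵐ a ∂ν, 0 < a) {ε : ℝ≥0∞} (hε : 0 < ε) :
    ∃ ξ : ℝ≥0, 0 < ξ ∧ ν (Set.Iio ξ) ≤ ε := by
  have h0 : ν (⋂ n : ℕ, Set.Iio (1 / ((n : ℝ≥0) + 1))) = 0 := by
    refine measure_mono_null (fun a ha => ?_) hpos
    simp only [Set.mem_iInter, Set.mem_Iio] at ha
    change ¬ 0 < a
    intro hapos
    obtain ⟨n, hn⟩ := exists_nat_one_div_lt (show (0 : ℝ) < a from hapos)
    exact absurd (ha n) (not_lt.2 (by exact_mod_cast hn.le))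
  have ht := tendsto_measure_iInter_atTop (μ := ν)
    (s := fun n : ℕ => Set.Iio (1 / ((n : ℝ≥0) + 1)))
    (fun n => measurableSet_Iio.nullMeasurableSet)
    (fun m n hmn => Set.Iio_subset_Iio (by gcongr))
    ⟨0, measure_ne_top _ _⟩
  rw [h0] at ht
  obtain ⟨n, hn⟩ := (ht.eventually_lt_const hε).exists
  exact ⟨_, by positivity, hn.le⟩

/-- The environments for which some path range of cardinal `m`, started near the origin on the
`i`-th axis, has at least half of its edges of conductance below `ξ`. -/
def weakContour {d : ℕ} (i : Fin d) (ξ : ℝ≥0) (m : ℕ) : Set (Environment d) :=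
  ⋃ k ∈ Finset.range (2 * m + 1),
    ⋃ S ∈ (pathRanges (2 * (m - 1)) (Pi.single i (k : ℤ), i)).filter fun S => S.card = m,
      ⋃ T ∈ S.powerset.filter fun T => m ≤ 2 * T.card, {ω | ∀ p ∈ T, ω (latticeEdge p) < ξ}

/-- Union bound over 2m + 1 starting edges, at most (3^d d)^(2m) contours and 2^m subsets. The
square on `r` compensates for only half of the edges being weak. -/
theorem iidLaw_weakContour_le {d : ℕ} (ν : Measure ℝ≥0) [IsProbabilityMeasure ν] (i : Fin d)
    {ξ r : ℝ≥0} (hr : r ≤ 1) (hξ : ν (Set.Iio ξ) ≤ (r : ℝ≥0∞) ^ 2) (m : ℕ) :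
    iidLaw d ν (weakContour i ξ m) ≤
      ((2 * m + 1) * (2 * ((3 : ℝ≥0) ^ d * d) ^ 2 * r) ^ m : ℝ≥0) := by
  have hd : 1 ≤ d := by have := i.2; omega
  have hD : 1 ≤ 3 ^ d * d := Nat.mul_pos (by positivity) hd
  have hT : ∀ T : Finset ((Fin d → ℤ) × Fin d), m ≤ 2 * T.card →
      iidLaw d ν {ω | ∀ p ∈ T, ω (latticeEdge p) < ξ} ≤ ((r ^ m : ℝ≥0) : ℝ≥0∞) := by
    intro T hT
    rw [iidLaw_forall_lt]
    refine (pow_le_pow_left' hξ _).trans ?_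
    rw [← pow_mul, ← ENNReal.coe_pow, ENNReal.coe_le_coe]
    exact pow_le_pow_of_le_one (zero_le) hr hT
  have hS : ∀ S : Finset ((Fin d → ℤ) × Fin d), S.card = m →
      iidLaw d ν (⋃ T ∈ S.powerset.filter fun T => m ≤ 2 * T.card,
        {ω | ∀ p ∈ T, ω (latticeEdge p) < ξ}) ≤ ((2 ^ m * r ^ m : ℝ≥0) : ℝ≥0∞) := by
    intro S hS
    refine (measure_biUnion_finset_le _ _).trans ?_
    refine (Finset.sum_le_card_nsmul _ _ _ fun T hTm => hT T (Finset.mem_filter.1 hTm).2).trans ?_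
    rw [nsmul_eq_mul, ENNReal.coe_mul]
    gcongr
    have : (S.powerset.filter fun T => m ≤ 2 * T.card).card ≤ 2 ^ m := by
      rw [← hS, ← Finset.card_powerset]
      exact Finset.card_filter_le _ _
    exact_mod_cast this
  have hk : ∀ k : ℕ, iidLaw d ν
      (⋃ S ∈ (pathRanges (2 * (m - 1)) (Pi.single i (k : ℤ), i)).filter fun S => S.card = m,
        ⋃ T ∈ S.powerset.filter fun T => m ≤ 2 * T.card, {ω | ∀ p ∈ T, ω (latticeEdge p) < ξ}) ≤
      ((((3 : ℝ≥0) ^ d * d) ^ (2 * m) * (2 ^ m * r ^ m) : ℝ≥0) : ℝ≥0∞) := by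
    intro k
    refine (measure_biUnion_finset_le _ _).trans ?_
    refine (Finset.sum_le_card_nsmul _ _ _ fun S hSm => hS S (Finset.mem_filter.1 hSm).2).trans ?_
    rw [nsmul_eq_mul, ENNReal.coe_mul (((3 : ℝ≥0) ^ d * d) ^ (2 * m))]
    gcongr
    have : ((pathRanges (2 * (m - 1)) (Pi.single i (k : ℤ), i)).filter
        fun S => S.card = m).card ≤ (3 ^ d * d) ^ (2 * m) :=
      (Finset.card_filter_le _ _).trans ((card_pathRanges_le _ _).trans
        (Nat.pow_le_pow_right hD (by omega)))
    exact_mod_cast this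
  refine (measure_biUnion_finset_le _ _).trans ?_
  refine (Finset.sum_le_card_nsmul _ _ _ fun k _ => hk k).trans ?_
  rw [nsmul_eq_mul, Finset.card_range]
  refine le_of_eq ?_
  rw [show ((2 * m + 1 : ℕ) : ℝ≥0∞) = ((2 * m + 1 : ℝ≥0) : ℝ≥0∞) by push_cast; rfl,
    ← ENNReal.coe_mul]
  congr 1
  rw [mul_pow, mul_pow, pow_mul]
  ring

theorem ae_eventually_notMem_weakContour {d : ℕ} (ν : Measure ℝ≥0) [IsProbabilityMeasure ν]
    (hpos : ∀ᵐ a ∂ν, 0 < a) (i : Fin d) :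
    ∃ ξ : ℝ≥0, 0 < ξ ∧
      ∀ᵐ ω ∂iidLaw d ν, ∀ᶠ m : ℕ in Filter.atTop, ω ∉ weakContour i ξ m := by
  have hd : 1 ≤ d := by have := i.2; omega
  set D : ℝ≥0 := (3 : ℝ≥0) ^ d * d with hDdef
  have hD : 1 ≤ D := by
    have : 1 ≤ 3 ^ d * d := Nat.mul_pos (by positivity) hd
    rw [hDdef]
    exact_mod_cast this
  have hD0 : D ≠ 0 := (lt_of_lt_of_le one_pos hD).ne'
  -- Chosen so that the ratio 2 D² r of the union bound is 1/2, which makes the probabilities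
  -- summable.
  let r : ℝ≥0 := (4 * D ^ 2)⁻¹
  have hr : r ≤ 1 := by
    refine inv_le_one_of_one_le₀ ?_
    have : 1 ≤ D ^ 2 := one_le_pow₀ hD
    linarith
  have hr0 : 0 < r := by positivity
  have hr2 : 2 * D ^ 2 * r = 1 / 2 := by
    simp only [r]
    field_simp
    norm_num
  obtain ⟨ξ, hξ, hle⟩ := exists_measure_Iio_le ν hpos (ε := (r : ℝ≥0∞) ^ 2) (by positivity)
  refine ⟨ξ, hξ, ae_eventually_notMem ?_⟩
  have hb : ∀ m, iidLaw d ν (weakContour i ξ m) ≤ ((2 * m + 1) * (1 / 2 : ℝ≥0) ^ m : ℝ≥0) :=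
    fun m => hr2 ▸ iidLaw_weakContour_le ν i hr hle m
  refine ne_top_of_le_ne_top ?_ (ENNReal.tsum_le_tsum hb)
  rw [ENNReal.tsum_coe_ne_top_iff_summable, ← NNReal.summable_coe]
  push_cast
  have h1 : Summable fun m : ℕ => (m : ℝ) ^ 1 * (1 / 2 : ℝ) ^ m :=
    summable_pow_mul_geometric_of_norm_lt_one 1 (by norm_num)
  have h2 : Summable fun m : ℕ => (1 / 2 : ℝ) ^ m :=
    summable_geometric_of_lt_one (by norm_num) (by norm_num)
  refine ((h1.mul_left 2).add h2).congr fun m => ?_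
  simp only [one_div, pow_one]
  ring

/-- Almost surely, the strong edges alone satisfy the isoperimetric inequality for all large
linked sets. -/
theorem ae_exists_strong_isoperimetry {d : ℕ} (hd : 3 ≤ d) (ν : Measure ℝ≥0)
    [IsProbabilityMeasure ν] (hpos : ∀ᵐ a ∂ν, 0 < a) :
    ∃ ξ : ℝ≥0, 0 < ξ ∧ ∀ᵐ ω ∂iidLaw d ν, ∃ N : ℕ, ∀ A : Finset (Fin d → ℤ), IsLinked A →
      N ≤ A.card → ∃ S ⊆ edgeBoundary A, (∀ p ∈ S, ξ ≤ ω (latticeEdge p)) ∧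
        A.card ^ (d - 1) ≤ (2 * S.card) ^ d := by
  let i₀ : Fin d := ⟨0, by omega⟩
  let i₁ : Fin d := ⟨1, by omega⟩
  have hi : i₀ ≠ i₁ := by simp [i₀, i₁]
  obtain ⟨ξ, hξ, hae⟩ := ae_eventually_notMem_weakContour ν hpos i₀
  refine ⟨ξ, hξ, hae.mono fun ω hω => ?_⟩
  obtain ⟨M, hM⟩ := Filter.eventually_atTop.1 hω
  -- As |A| ≤ |A|^(d-1) ≤ |S|^d, this size forces the contour to have at least `M` edges.
  refine ⟨M ^ d, fun A hA hNA => ?_⟩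
  obtain ⟨S, hSA, hcard, k, hk, hpath⟩ := hA.exists_pathRange hi
  have hMS : M ≤ S.card := by
    by_contra hlt
    push Not at hlt
    have h1 : S.card ^ d < M ^ d := Nat.pow_lt_pow_left hlt (by omega)
    have h2 : A.card ≤ A.card ^ (d - 1) := Nat.le_self_pow (by omega) _
    omega
  have hnot := hM S.card hMS
  simp only [weakContour, Set.mem_iUnion, not_exists, Finset.mem_range, Finset.mem_filter,
    Finset.mem_powerset, Set.mem_ofPred_eq] at hnot
  have hweak := hnot k (by omega) S ⟨hpath, rfl⟩ (S.filter fun p => ω (latticeEdge p) < ξ)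
  have hlt : 2 * (S.filter fun p => ω (latticeEdge p) < ξ).card < S.card := by
    by_contra hge
    push Not at hge
    exact hweak ⟨Finset.filter_subset _ _, hge⟩ fun p hp => (Finset.mem_filter.1 hp).2
  refine ⟨S.filter fun p => ¬ ω (latticeEdge p) < ξ, (Finset.filter_subset _ _).trans hSA,
    fun p hp => not_lt.1 (Finset.mem_filter.1 hp).2, hcard.trans (Nat.pow_le_pow_left ?_ _)⟩
  have := S.card_filter_add_card_filter_not fun p => ω (latticeEdge p) < ξ
  omega

/-! ### Superlevel sets of a potential -/

section Potential

variable {d : ℕ}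

/-- The current through an edge for the conductances `w` and the potential `u`. -/
def edgeCurrent (w : (Fin d → ℤ) × Fin d → ℝ) (u : (Fin d → ℤ) → ℝ) (p : (Fin d → ℤ) × Fin d) : ℝ :=
  w p * (u p.1 - u (p.1 + unitVec p.2))

/-- The total current flowing out of a point. -/
def currentDiv (w : (Fin d → ℤ) × Fin d → ℝ) (u : (Fin d → ℤ) → ℝ) (y : Fin d → ℤ) : ℝ :=
  ∑ i, (edgeCurrent w u (y, i) - edgeCurrent w u (y - unitVec i, i))

/-- Discrete divergence theorem: currents along edges inside `A` cancel. -/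
theorem sum_currentDiv (w : (Fin d → ℤ) × Fin d → ℝ) (u : (Fin d → ℤ) → ℝ)
    (A : Finset (Fin d → ℤ)) :
    ∑ y ∈ A, currentDiv w u y =
      ∑ p ∈ edgeBoundary A, (if p.1 ∈ A then 1 else -1) * edgeCurrent w u p := by
  classical
  set Λ := A ∪ A.biUnion fun y => Finset.univ.image fun i => y - unitVec i with hΛ
  have hR : ∑ p ∈ edgeBoundary A, (if p.1 ∈ A then 1 else -1) * edgeCurrent w u p =
      ∑ p ∈ Λ ×ˢ Finset.univ, ((if p.1 ∈ A then edgeCurrent w u p else 0) -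
        (if p.1 + unitVec p.2 ∈ A then edgeCurrent w u p else 0)) := by
    rw [edgeBoundary, Finset.sum_filter]
    refine Finset.sum_congr rfl fun p _ => ?_
    by_cases h1 : p.1 ∈ A <;> by_cases h2 : p.1 + unitVec p.2 ∈ A <;> simp [h1, h2]
  rw [hR, Finset.sum_product_right]
  simp only [currentDiv]
  rw [Finset.sum_comm]
  refine Finset.sum_congr rfl fun i _ => ?_
  rw [Finset.sum_sub_distrib, Finset.sum_sub_distrib]
  congr 1
  · rw [← Finset.sum_filter]
    refine Finset.sum_congr ?_ fun _ _ => rfl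
    ext x
    simp only [hΛ, Finset.mem_filter, Finset.mem_union]
    tauto
  · rw [← Finset.sum_filter]
    refine Finset.sum_bij' (fun y _ => y - unitVec i) (fun x _ => x + unitVec i) ?_ ?_ ?_ ?_ ?_
    · intro y hy
      simp only [hΛ, Finset.mem_filter, Finset.mem_union, Finset.mem_biUnion, Finset.mem_image,
        Finset.mem_univ, true_and, sub_add_cancel, hy, and_true]
      exact Or.inr ⟨y, hy, i, rfl⟩
    · intro x hx
      exact (Finset.mem_filter.1 hx).2
    all_goals simp

theorem edgeBoundary_nonempty (i : Fin d) {A : Finset (Fin d → ℤ)} (hA : A.Nonempty) :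
    (edgeBoundary A).Nonempty := by
  obtain ⟨x, hx, hmax⟩ := Finset.exists_max_image A (fun x => x i) hA
  refine ⟨(x, i), mem_edgeBoundary.2 fun h => ?_⟩
  have := hmax _ (h.1 hx)
  simp at this

/-- The points of `U` where `u` exceeds `s`. -/
noncomputable def superlevel (U : Finset (Fin d → ℤ)) (u : (Fin d → ℤ) → ℝ) (s : ℝ) :
    Finset (Fin d → ℤ) := U.filter fun y => s < u y

/-- `u` vanishes outside `U` and is the potential of a unit source at the origin, up to sinks. -/
structure IsSubpotential (w : (Fin d → ℤ) × Fin d → ℝ) (U : Finset (Fin d → ℤ))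
    (u : (Fin d → ℤ) → ℝ) : Prop where
  pos : ∀ p, 0 < w p
  eq_zero : ∀ y ∉ U, u y = 0
  div_le : ∀ y, currentDiv w u y ≤ if y = 0 then 1 else 0

variable {w : (Fin d → ℤ) × Fin d → ℝ} {U : Finset (Fin d → ℤ)} {u : (Fin d → ℤ) → ℝ}

namespace IsSubpotential

theorem mem_superlevel (h : IsSubpotential w U u) {s : ℝ} (hs : 0 ≤ s) {y : Fin d → ℤ} :
    y ∈ superlevel U u s ↔ s < u y := by
  rw [superlevel, Finset.mem_filter, and_iff_right_iff_imp]
  intro hy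
  by_contra hU
  rw [h.eq_zero y hU] at hy
  linarith

theorem superlevel_anti (h : IsSubpotential w U u) {s t : ℝ} (ht : 0 ≤ t) (hts : t ≤ s) :
    superlevel U u s ⊆ superlevel U u t := fun y hy => by
  rw [h.mem_superlevel (ht.trans hts)] at hy
  rw [h.mem_superlevel ht]
  linarith

/-- Maximum principle: every boundary edge of `K` leaves the superlevel set, so a strictly positive
current flows out of `K`, and only the origin can supply it. -/
theorem zero_mem_of_separated (h : IsSubpotential w U u) (i : Fin d) {s : ℝ} (hs : 0 ≤ s)
    {K : Finset (Fin d → ℤ)} (hK : K ⊆ superlevel U u s) (hne : K.Nonempty)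
    (hsep : ∀ x i, x ∈ superlevel U u s → x + unitVec i ∈ superlevel U u s →
      (x ∈ K ↔ x + unitVec i ∈ K)) : 0 ∈ K := by
  by_contra h0
  have h1 : ∑ y ∈ K, currentDiv w u y ≤ 0 := Finset.sum_nonpos fun y hy => by
    have := h.div_le y
    rwa [if_neg (fun hy0 : y = 0 => h0 (hy0 ▸ hy))] at this
  have h2 : 0 < ∑ p ∈ edgeBoundary K, (if p.1 ∈ K then 1 else -1) * edgeCurrent w u p := by
    refine Finset.sum_pos (fun p hp => ?_) (edgeBoundary_nonempty i hne)
    rw [mem_edgeBoundary] at hp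
    have hw := h.pos p
    unfold edgeCurrent
    by_cases hp1 : p.1 ∈ K
    · have hp2 : p.1 + unitVec p.2 ∉ superlevel U u s := fun hc =>
        hp (hsep p.1 p.2 (hK hp1) hc)
      have a1 := (h.mem_superlevel hs).1 (hK hp1)
      rw [h.mem_superlevel hs, not_lt] at hp2
      rw [if_pos hp1, one_mul]
      exact mul_pos hw (by linarith)
    · have hp2 : p.1 + unitVec p.2 ∈ K := by
        by_contra hc
        exact hp (by simp [hp1, hc])
      have hp3 : p.1 ∉ superlevel U u s := fun hc => hp (hsep p.1 p.2 hc (hK hp2))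
      have a1 := (h.mem_superlevel hs).1 (hK hp2)
      rw [h.mem_superlevel hs, not_lt] at hp3
      rw [if_neg hp1, neg_one_mul, neg_pos]
      exact mul_neg_of_pos_of_neg hw (by linarith)
  rw [sum_currentDiv] at h1
  linarith

theorem zero_mem_superlevel (h : IsSubpotential w U u) (i : Fin d) {s : ℝ} (hs : 0 ≤ s)
    (hne : (superlevel U u s).Nonempty) : 0 ∈ superlevel U u s :=
  h.zero_mem_of_separated i hs subset_rfl hne fun x i hx hxi => by simp [hx, hxi]

theorem isLinked_superlevel (h : IsSubpotential w U u) (i : Fin d) {s : ℝ} (hs : 0 ≤ s)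
    (hne : (superlevel U u s).Nonempty) : IsLinked (superlevel U u s) := by
  refine ⟨h.zero_mem_superlevel i hs hne, fun K hK h0 hsep => ?_⟩
  by_contra hKne
  have := h.zero_mem_of_separated i hs (K := superlevel U u s \ K) Finset.sdiff_subset
    (Finset.sdiff_nonempty.2 fun hc => hKne (hK.antisymm hc)) fun x i hx hxi => by
      simp [hx, hxi, hsep x i hx hxi]
  exact (Finset.mem_sdiff.1 this).2 h0

/-- All boundary currents of a superlevel set point outwards, so their absolute values add up to the
total divergence inside, at most the unit source. -/
theorem sum_boundary_le (h : IsSubpotential w U u) {s : ℝ} (hs : 0 ≤ s) :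
    ∑ p ∈ edgeBoundary (superlevel U u s), w p * |u p.1 - u (p.1 + unitVec p.2)| ≤ 1 := by
  have h1 : ∑ y ∈ superlevel U u s, currentDiv w u y ≤ 1 := by
    refine (Finset.sum_le_sum fun y _ => h.div_le y).trans ?_
    rw [Finset.sum_ite_eq']
    split_ifs <;> norm_num
  rw [sum_currentDiv] at h1
  refine le_of_eq_of_le (Finset.sum_congr rfl fun p hp => ?_) h1
  rw [mem_edgeBoundary, h.mem_superlevel hs, h.mem_superlevel hs] at hp
  simp only [h.mem_superlevel hs]
  unfold edgeCurrent
  by_cases h1 : s < u p.1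
  · have h2 : u (p.1 + unitVec p.2) ≤ s := by
      by_contra hc
      push Not at hc
      exact hp (by simp [h1, hc])
    rw [if_pos h1, abs_of_pos (by linarith), one_mul]
  · have h2 : s < u (p.1 + unitVec p.2) := by
      by_contra hc
      exact hp (by simp [h1, hc])
    rw [if_neg h1, abs_of_neg (by linarith)]
    ring

/-- If the superlevel set at height `s` has `g` boundary edges of conductance at least `ξ`, then
lowering the height by `2 / (ξ g)` adds at least `g / (4 d)` points to it. -/
theorem card_superlevel_sub (h : IsSubpotential w U u) {ξ s δ : ℝ} (hξ : 0 < ξ) (hδs : δ ≤ s)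
    {S : Finset ((Fin d → ℤ) × Fin d)} (hS : S ⊆ edgeBoundary (superlevel U u s))
    (hw : ∀ p ∈ S, ξ ≤ w p) (hδ : 2 ≤ ξ * S.card * δ) :
    ((superlevel U u s).card : ℝ) + S.card / (4 * d) ≤ (superlevel U u (s - δ)).card := by
  classical
  have hSpos : 0 < (S.card : ℝ) := by
    rcases (Nat.cast_nonneg (α := ℝ) S.card).eq_or_lt with h0 | h0
    · rw [← h0] at hδ; norm_num at hδ
    · exact h0
  have hδ0 : 0 < δ := by
    by_contra hc
    push Not at hc
    have := mul_nonpos_of_nonneg_of_nonpos (mul_nonneg hξ.le hSpos.le) hc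
    linarith
  have hs : 0 ≤ s := hδ0.le.trans hδs
  set A := superlevel U u s with hA
  let gap : (Fin d → ℤ) × Fin d → ℝ := fun p => |u p.1 - u (p.1 + unitVec p.2)|
  have hd0 : 0 < d := by
    obtain ⟨p, hp⟩ := Finset.card_pos.1 (by exact_mod_cast hSpos : 0 < S.card)
    have := p.2.2
    omega
  have hsum : ∑ p ∈ S, ξ * gap p ≤ 1 := by
    refine le_trans ?_ (h.sum_boundary_le hs)
    refine (Finset.sum_le_sum fun p hp =>
      mul_le_mul_of_nonneg_right (hw p hp) (abs_nonneg _)).trans ?_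
    exact Finset.sum_le_sum_of_subset_of_nonneg hS fun p _ _ =>
      mul_nonneg (h.pos p).le (abs_nonneg _)
  -- Markov's inequality: each steep edge carries current at least ξδ, out of a total of at most 1.
  have hsteep : ((S.filter fun p => ¬ gap p < δ).card : ℝ) ≤ S.card / 2 := by
    have h1 : ((S.filter fun p => ¬ gap p < δ).card : ℝ) * (ξ * δ) ≤ 1 := by
      refine le_trans ?_ hsum
      rw [← nsmul_eq_mul]
      refine (Finset.card_nsmul_le_sum _ (fun p => ξ * gap p) _ fun p hp => ?_).trans
        (Finset.sum_le_sum_of_subset_of_nonneg (Finset.filter_subset _ _) fun p _ _ =>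
          mul_nonneg hξ.le (abs_nonneg _))
      exact mul_le_mul_of_nonneg_left (not_lt.1 (Finset.mem_filter.1 hp).2) hξ.le
    have h2 : 0 < ξ * δ := mul_pos hξ hδ0
    by_contra hc
    rw [not_le] at hc
    nlinarith [mul_lt_mul_of_pos_right hc h2]
  have hflat : (S.card : ℝ) / 2 ≤ (S.filter fun p => gap p < δ).card := by
    have : ((S.filter fun p => gap p < δ).card : ℝ) + (S.filter fun p => ¬ gap p < δ).card =
        S.card := by exact_mod_cast S.card_filter_add_card_filter_not fun p => gap p < δ
    linarith
  -- The outer endpoint of a flat edge lies in the lower superlevel set; it is shared by at most 2d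
  -- edges.
  let out : (Fin d → ℤ) × Fin d → (Fin d → ℤ) := fun p =>
    if p.1 ∈ A then p.1 + unitVec p.2 else p.1
  set O := (S.filter fun p => gap p < δ).image out with hO
  have hfib : (S.filter fun p => gap p < δ).card ≤ 2 * d * O.card := by
    refine Finset.card_le_mul_card_image _ _ fun y _ => ?_
    have : ((S.filter fun p => gap p < δ).filter fun p => out p = y) ⊆
        (Finset.univ.image fun i => (y, i)) ∪ (Finset.univ.image fun i => (y - unitVec i, i)) := by
      rintro ⟨x, i⟩ hp
      have hout := (Finset.mem_filter.1 hp).2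
      simp only [out] at hout
      simp only [Finset.mem_union, Finset.mem_image, Finset.mem_univ, true_and, Prod.mk.injEq]
      split_ifs at hout
      · exact Or.inr ⟨i, by rw [← hout]; simp, rfl⟩
      · exact Or.inl ⟨i, hout.symm, rfl⟩
    refine (Finset.card_le_card this).trans ((Finset.card_union_le _ _).trans ?_)
    have c1 := Finset.card_image_le (s := (Finset.univ : Finset (Fin d))) (f := fun i => (y, i))
    have c2 := Finset.card_image_le (s := (Finset.univ : Finset (Fin d)))
      (f := fun i => (y - unitVec i, i))
    rw [Finset.card_univ, Fintype.card_fin] at c1 c2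
    omega
  have hOprop : ∀ y ∈ O, y ∉ A ∧ y ∈ superlevel U u (s - δ) := by
    intro y hy
    obtain ⟨p, hp, rfl⟩ := Finset.mem_image.1 hy
    obtain ⟨hpS, hgap⟩ := Finset.mem_filter.1 hp
    have hb := mem_edgeBoundary.1 (hS hpS)
    have hsδ : 0 ≤ s - δ := by linarith
    have hgap' := abs_lt.1 hgap
    by_cases h1 : p.1 ∈ A
    · have h2 : p.1 + unitVec p.2 ∉ A := fun hc => hb (by simp [h1, hc])
      simp only [out, if_pos h1]
      refine ⟨h2, (h.mem_superlevel hsδ).2 ?_⟩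
      have := (h.mem_superlevel hs).1 h1
      linarith
    · have h2 : p.1 + unitVec p.2 ∈ A := by
        by_contra hc
        exact hb (by simp [h1, hc])
      simp only [out, if_neg h1]
      refine ⟨h1, (h.mem_superlevel hsδ).2 ?_⟩
      have := (h.mem_superlevel hs).1 h2
      linarith
  have hcard : A.card + O.card ≤ (superlevel U u (s - δ)).card := by
    rw [← Finset.card_union_of_disjoint
      (Finset.disjoint_right.2 fun y hy => (hOprop y hy).1)]
    exact Finset.card_le_card (Finset.union_subset
      (h.superlevel_anti (by linarith) (by linarith)) fun y hy => (hOprop y hy).2)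
  have hcard' : (A.card : ℝ) + O.card ≤ (superlevel U u (s - δ)).card := by exact_mod_cast hcard
  have hfib' : ((S.filter fun p => gap p < δ).card : ℝ) ≤ 2 * d * O.card := by
    exact_mod_cast hfib
  have hdR : (0 : ℝ) < d := by exact_mod_cast hd0
  have : (S.card : ℝ) / (4 * d) ≤ O.card := by
    rw [div_le_iff₀ (by positivity)]
    linarith
  linarith

end IsSubpotential

end Potential

/-! ### Height and sum bounds for the potential -/

/-- Bernoulli's inequality for (1 - h/(1+h))^a, with 1/6 = 1/3 · 1/2. It is applied with a = 1 -
2/d, where a ≥ 1/3 means d ≥ 3. -/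
theorem rpow_neg_one_add_le {a h : ℝ} (ha : 1 / 3 ≤ a) (ha1 : a ≤ 1) (hh : 0 ≤ h) (hh1 : h ≤ 1) :
    (1 + h) ^ (-a) ≤ 1 - h / 6 := by
  have h0 : 0 < 1 + h := by linarith
  have e1 : (1 + h) ^ (-a) = (1 + -(h / (1 + h))) ^ a := by
    have : 1 + -(h / (1 + h)) = (1 + h)⁻¹ := by field_simp; ring
    rw [this, Real.inv_rpow h0.le, Real.rpow_neg h0.le]
  have hle : h / (1 + h) ≤ 1 := by rw [div_le_one h0]; linarith
  have e2 := rpow_one_add_le_one_add_mul_self (s := -(h / (1 + h))) (by linarith)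
    (by linarith : 0 ≤ a) ha1
  have e3 : h / 2 ≤ h / (1 + h) := by gcongr; linarith
  rw [e1]
  nlinarith

/-- The arithmetic of one growth step of the superlevel sets. -/
theorem decay_step {d : ℕ} (hd : 3 ≤ d) {n n' ξ : ℝ} (hn : 1 ≤ n) (hξ : 0 < ξ)
    (hn' : n + n ^ (1 - 1 / d : ℝ) / (8 * d) ≤ n') :
    192 * d / ξ * n' ^ (2 / d - 1 : ℝ) + 4 / ξ * n ^ (1 / d - 1 : ℝ) ≤
      192 * d / ξ * n ^ (2 / d - 1 : ℝ) := by
  have hd3 : (3 : ℝ) ≤ d := by exact_mod_cast hd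
  have hd0 : (0 : ℝ) < d := by linarith
  have hn0 : 0 < n := by linarith
  set h : ℝ := n ^ (-(1 / d) : ℝ) / (8 * d) with hh
  have hh0 : 0 ≤ h := by positivity
  have hh1 : h ≤ 1 := by
    have h1 : n ^ (-(1 / d) : ℝ) ≤ 1 :=
      Real.rpow_le_one_of_one_le_of_nonpos hn (by rw [neg_nonpos]; positivity)
    rw [hh, div_le_one (by positivity)]
    linarith
  have hmul : n * (1 + h) ≤ n' := by
    refine le_trans (le_of_eq ?_) hn'
    rw [hh, sub_eq_add_neg, Real.rpow_add hn0, Real.rpow_one]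
    ring
  have h2d : (2 : ℝ) / d ≤ 2 / 3 := by gcongr
  have h2d0 : 0 < (2 : ℝ) / d := by positivity
  have h1 : n' ^ (2 / d - 1 : ℝ) ≤ n ^ (2 / d - 1 : ℝ) * (1 - h / 6) := by
    refine (Real.rpow_le_rpow_of_nonpos (by positivity) hmul (by linarith)).trans ?_
    rw [Real.mul_rpow hn0.le (by positivity)]
    gcongr
    have := rpow_neg_one_add_le (a := 1 - 2 / d) (by linarith) (by linarith) hh0 hh1
    rwa [neg_sub] at this
  have h2 : n ^ (2 / d - 1 : ℝ) * h = n ^ (1 / d - 1 : ℝ) / (8 * d) := by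
    rw [hh, ← mul_div_assoc, ← Real.rpow_add hn0]
    congr 2
    ring
  -- The source of 192 = 4 · 8 · 6: the height step 4/ξ, the growth rate 1/(8d) and the 1/6 from
  -- Bernoulli.
  have h3 : 192 * d / ξ * (n ^ (2 / d - 1 : ℝ) * h / 6) = 4 / ξ * n ^ (1 / d - 1 : ℝ) := by
    rw [h2]
    field_simp
    norm_num
  have h4 := mul_le_mul_of_nonneg_left h1 (by positivity : 0 ≤ 192 * d / ξ)
  linarith

theorem rpow_le_two_mul_card {d n g : ℕ} (hd : 3 ≤ d) (h : n ^ (d - 1) ≤ (2 * g) ^ d) :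
    (n : ℝ) ^ (1 - 1 / d : ℝ) ≤ 2 * g := by
  have hd0 : (0 : ℝ) < d := by exact_mod_cast (by omega : 0 < d)
  have h1 : ((n : ℝ)) ^ ((d - 1 : ℕ) : ℝ) ≤ (2 * g : ℝ) ^ (d : ℝ) := by
    rw [Real.rpow_natCast, Real.rpow_natCast]
    exact_mod_cast h
  have h2 := Real.rpow_le_rpow (by positivity) h1 (by positivity : (0 : ℝ) ≤ 1 / d)
  rw [← Real.rpow_mul (by positivity), ← Real.rpow_mul (by positivity), mul_one_div_cancel hd0.ne',
    Real.rpow_one] at h2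
  refine le_of_eq_of_le ?_ h2
  congr 1
  rw [Nat.cast_sub (by omega)]
  field_simp
  norm_num

/-- Strong edges of conductance at least `ξ` satisfy the isoperimetric inequality for linked sets
of at least `N` points. -/
def StrongIsoperimetry {d : ℕ} (w : (Fin d → ℤ) × Fin d → ℝ) (ξ : ℝ) (N : ℕ) : Prop :=
  ∀ A : Finset (Fin d → ℤ), IsLinked A → N ≤ A.card →
    ∃ S ⊆ edgeBoundary A, (∀ p ∈ S, ξ ≤ w p) ∧ A.card ^ (d - 1) ≤ (2 * S.card) ^ d

namespace IsSubpotential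

variable {d : ℕ} {w : (Fin d → ℤ) × Fin d → ℝ} {U : Finset (Fin d → ℤ)} {u : (Fin d → ℤ) → ℝ}

/-- A superlevel set of at least `n ≥ N` points has height at most `(192 d / ξ) n ^ (2/d - 1)`. -/
theorem height_le (hd : 3 ≤ d) (h : IsSubpotential w U u) {ξ : ℝ} (hξ : 0 < ξ) {N : ℕ}
    (hiso : StrongIsoperimetry w ξ N) {s : ℝ} (hs : 0 ≤ s) (h1 : 1 ≤ (superlevel U u s).card)
    (hN : N ≤ (superlevel U u s).card) :
    s ≤ 192 * d / ξ * ((superlevel U u s).card : ℝ) ^ (2 / d - 1 : ℝ) := by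
  have hd3 : (3 : ℝ) ≤ d := by exact_mod_cast hd
  have hd0 : (0 : ℝ) < d := by linarith
  induction hk : U.card - (superlevel U u s).card using Nat.strong_induction_on generalizing s with
  | _ k ih =>
  obtain ⟨S, hS, hSw, hScard⟩ := hiso _
    (h.isLinked_superlevel ⟨0, by omega⟩ hs (Finset.card_pos.1 h1)) hN
  set n : ℝ := ((superlevel U u s).card : ℝ) with hn
  have hn1 : 1 ≤ n := by rw [hn]; exact_mod_cast h1
  have hn0 : 0 < n := by linarith
  have hg := rpow_le_two_mul_card hd hScard
  rw [← hn] at hg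
  -- At least 2/(ξ|S|), as `card_superlevel_sub` requires, because |S| ≥ n^(1-1/d)/2. If s < δ, the
  -- bound is immediate; otherwise descend to s - δ, where the superlevel set is strictly larger.
  set δ : ℝ := 4 / ξ * n ^ (1 / d - 1 : ℝ) with hδ
  have hδ0 : 0 < δ := by positivity
  rcases lt_or_ge s δ with hlt | hge
  · refine hlt.le.trans ?_
    rw [hδ]
    gcongr ?_ * ?_
    · gcongr
      linarith
    · refine Real.rpow_le_rpow_of_exponent_le hn1 ?_
      gcongr
      norm_num
  · have hprod : 2 ≤ ξ * S.card * δ := by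
      have e : ξ * (n ^ (1 - 1 / d : ℝ) / 2) * δ = 2 := by
        have e1 : n ^ (1 - 1 / d : ℝ) * n ^ (1 / d - 1 : ℝ) = 1 := by
          rw [← Real.rpow_add hn0]
          simp
        have e2 : ξ * (4 / ξ) = 4 := by field_simp
        rw [hδ]
        linear_combination (ξ * (4 / ξ) / 2) * e1 + e2 / 2
      rw [← e]
      gcongr
      linarith
    have hgrow := h.card_superlevel_sub hξ hge hS hSw hprod
    rw [← hn] at hgrow
    have hn' : n + n ^ (1 - 1 / d : ℝ) / (8 * d) ≤ (superlevel U u (s - δ)).card := by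
      refine le_trans ?_ hgrow
      have e2 : n ^ (1 - 1 / d : ℝ) / (8 * d) ≤ (2 * S.card) / (8 * d) := by gcongr
      have e3 : (2 * (S.card : ℝ)) / (8 * d) = S.card / (4 * d) := by
        field_simp; ring
      linarith
    have hlt : (superlevel U u s).card < (superlevel U u (s - δ)).card := by
      have : n < (superlevel U u (s - δ)).card := by
        have : 0 < n ^ (1 - 1 / d : ℝ) / (8 * d) := by positivity
        linarith
      rw [hn] at this
      exact_mod_cast this
    have hU : (superlevel U u (s - δ)).card ≤ U.card := Finset.card_filter_le _ _
    have hind := ih _ (by omega) (s := s - δ) (by linarith) (by omega) (by omega) rfl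
    have := decay_step hd hn1 hξ hn'
    linarith

theorem height_le_of_le (hd : 3 ≤ d) (h : IsSubpotential w U u) {ξ : ℝ} (hξ : 0 < ξ) {N : ℕ}
    (hiso : StrongIsoperimetry w ξ N) {s : ℝ} (hs : 0 ≤ s) {J : ℕ} (h1 : 1 ≤ J) (hN : N ≤ J)
    (hJ : J ≤ (superlevel U u s).card) : s ≤ 192 * d / ξ * (J : ℝ) ^ (2 / d - 1 : ℝ) := by
  have hd3 : (3 : ℝ) ≤ d := by exact_mod_cast hd
  refine (h.height_le hd hξ hiso hs (by omega) (by omega)).trans ?_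
  gcongr ?_ * ?_
  refine Real.rpow_le_rpow_of_nonpos (by exact_mod_cast h1) (by exact_mod_cast hJ) ?_
  have : (2 : ℝ) / d ≤ 2 / 3 := by gcongr
  linarith

/-- A bound on the potential which only involves conductances near the origin. -/
theorem le_of_strongIsoperimetry (hd : 3 ≤ d) (h : IsSubpotential w U u) {ξ κ : ℝ} (hξ : 0 < ξ)
    (hκ : 0 < κ) {N : ℕ} (hiso : StrongIsoperimetry w ξ N)
    (hκw : ∀ k < N, κ ≤ w (Pi.single ⟨0, by omega⟩ (k : ℤ), ⟨0, by omega⟩)) (y : Fin d → ℤ) :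
    u y ≤ 192 * d / ξ + N * (2 / κ) := by
  have hd3 : (3 : ℝ) ≤ d := by exact_mod_cast hd
  have hd0 : (0 : ℝ) < d := by linarith
  let i₀ : Fin d := ⟨0, by omega⟩
  have hbig : ∀ s : ℝ, 0 ≤ s → 1 ≤ (superlevel U u s).card → N ≤ (superlevel U u s).card →
      s ≤ 192 * d / ξ := fun s hs h1 hN => by
    refine (h.height_le hd hξ hiso hs h1 hN).trans ?_
    refine mul_le_of_le_one_right (by positivity) ?_
    refine Real.rpow_le_one_of_one_le_of_nonpos (by exact_mod_cast h1) ?_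
    have : (2 : ℝ) / d ≤ 2 / 3 := by gcongr
    linarith
  have key : ∀ j : ℕ, ∀ s : ℝ, 0 ≤ s → 1 ≤ (superlevel U u s).card →
      N ≤ (superlevel U u s).card + j → s ≤ 192 * d / ξ + j * (2 / κ) := by
    intro j
    induction j with
    | zero => intro s hs h1 hN; simpa using hbig s hs h1 hN
    | succ j ih =>
      intro s hs h1 hN
      by_cases hN' : N ≤ (superlevel U u s).card
      · have := hbig s hs h1 hN'
        have : 0 ≤ ((j + 1 : ℕ) : ℝ) * (2 / κ) := by positivity
        linarith
      push_cast
      rcases lt_or_ge s (2 / κ) with hlt | hge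
      · have : 0 ≤ (j : ℝ) * (2 / κ) := by positivity
        have : 0 ≤ 192 * d / ξ := by positivity
        linarith
      set A := superlevel U u s with hA
      have h0 : 0 ∈ A := h.zero_mem_superlevel i₀ hs (Finset.card_pos.1 h1)
      -- A set of fewer than `N` points containing 0 cannot contain the axis segment of N + 1
      -- points, so its boundary has an edge of conductance at least κ there. Lowering the height by
      -- 2/κ then gains at least one point.
      obtain ⟨k, hkN, hk⟩ : ∃ k < N, (Pi.single i₀ (k : ℤ), i₀) ∈ edgeBoundary A := by
        by_contra hc
        push Not at hc
        have hin : ∀ k ≤ N, (Pi.single i₀ (k : ℤ) : Fin d → ℤ) ∈ A := by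
          intro k
          induction k with
          | zero => intro _; simpa using h0
          | succ k ihk =>
            intro hk
            have h2 := hc k (by omega)
            rw [mem_edgeBoundary, not_not] at h2
            have h3 := h2.1 (ihk (by omega))
            simp only [unitVec] at h3
            rw [← Pi.single_add] at h3
            exact_mod_cast h3
        have hsub : (Finset.range (N + 1)).image (fun k : ℕ => (Pi.single i₀ (k : ℤ) : Fin d → ℤ))
            ⊆ A := by
          intro z hz
          obtain ⟨k, hk, rfl⟩ := Finset.mem_image.1 hz
          exact hin k (by have := Finset.mem_range.1 hk; omega)
        have hcard := Finset.card_le_card hsub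
        rw [Finset.card_image_of_injective _ fun a b hab => by
          exact_mod_cast Pi.single_injective i₀ hab, Finset.card_range] at hcard
        omega
      have hgrow := h.card_superlevel_sub (S := {(Pi.single i₀ (k : ℤ), i₀)}) hκ hge
        (by simpa using hk) (by simpa using hκw k hkN) (by
          rw [Finset.card_singleton]; field_simp; norm_num)
      have hlt : A.card < (superlevel U u (s - 2 / κ)).card := by
        have : (A.card : ℝ) < (superlevel U u (s - 2 / κ)).card := by
          refine lt_of_lt_of_le (lt_add_of_pos_right _ ?_) hgrow
          simp only [Finset.card_singleton, Nat.cast_one]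
          positivity
        exact_mod_cast this
      have := ih (s - 2 / κ) (by linarith) (by omega) (by omega)
      linarith
  have hC : 0 ≤ 192 * d / ξ + N * (2 / κ) := by positivity
  by_contra hlt
  push Not at hlt
  obtain ⟨s, hs1, hs2⟩ := exists_between hlt
  have hs0 : 0 ≤ s := hC.trans hs1.le
  have hne : 1 ≤ (superlevel U u s).card :=
    Finset.card_pos.2 ⟨y, (h.mem_superlevel hs0).2 hs2⟩
  have := key N s hs0 hne (by omega)
  linarith

/-- Rearrangement: the sum of the potential over `J` points is of order `J ^ (2/d)`. -/
theorem sum_le_card_rpow (hd : 3 ≤ d) (h : IsSubpotential w U u) {ξ M : ℝ} (hξ : 0 < ξ) {N : ℕ}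
    (hiso : StrongIsoperimetry w ξ N) (hM0 : 0 ≤ M) (hM : ∀ y, u y ≤ M) (F : Finset (Fin d → ℤ)) :
    ∑ y ∈ F, u y ≤ N * M + 192 * d / ξ * (d / 2) * (F.card : ℝ) ^ (2 / d : ℝ) := by
  have hd3 : (3 : ℝ) ≤ d := by exact_mod_cast hd
  have hd0 : (0 : ℝ) < d := by linarith
  have hda : (2 : ℝ) / d ≤ 1 := by rw [div_le_one hd0]; linarith
  induction hJ : F.card generalizing F with
  | zero =>
    rw [Finset.card_eq_zero.1 hJ, Finset.sum_empty]
    positivity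
  | succ J ih =>
    by_cases hJN : J + 1 ≤ N
    · refine (Finset.sum_le_card_nsmul F u M fun y _ => hM y).trans ?_
      rw [nsmul_eq_mul, hJ]
      have h1 : ((J + 1 : ℕ) : ℝ) * M ≤ N * M := by gcongr
      have h2 : 0 ≤ 192 * d / ξ * (d / 2) * ((J + 1 : ℕ) : ℝ) ^ (2 / d : ℝ) := by positivity
      linarith
    -- Remove the smallest value: all of `F` lies in superlevel sets just below it, so the height
    -- bound for J + 1 points applies.
    · obtain ⟨y, hy, hmin⟩ := Finset.exists_min_image F u (Finset.card_pos.1 (by omega))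
      have hyle : u y ≤ 192 * d / ξ * ((J + 1 : ℕ) : ℝ) ^ (2 / d - 1 : ℝ) := by
        by_contra hlt
        push Not at hlt
        obtain ⟨s, hs1, hs2⟩ := exists_between hlt
        have hs0 : 0 ≤ s := le_trans (by positivity) hs1.le
        have hsub : F ⊆ superlevel U u s := fun z hz =>
          (h.mem_superlevel hs0).2 (hs2.trans_le (hmin z hz))
        have := h.height_le_of_le hd hξ hiso hs0 (J := J + 1) (by omega) (by omega)
          (hJ ▸ Finset.card_le_card hsub)
        linarith
      have hcard : (F.erase y).card = J := by rw [Finset.card_erase_of_mem hy, hJ]; rfl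
      have hind := ih (F.erase y) hcard
      rw [← Finset.add_sum_erase F u hy]
      set n : ℝ := ((J + 1 : ℕ) : ℝ) with hn
      have hn0 : 0 < n := by positivity
      have hJn : (J : ℝ) = n * (1 + -(1 / n)) := by
        have : n = J + 1 := by rw [hn]; push_cast; rfl
        field_simp
        linarith
      have hn1 : 1 / n ≤ 1 := by
        rw [div_le_one hn0, hn]; push_cast; linarith [(Nat.cast_nonneg J : (0 : ℝ) ≤ J)]
      have hber := rpow_one_add_le_one_add_mul_self (s := -(1 / n)) (by linarith)
        (by positivity : (0 : ℝ) ≤ 2 / d) hda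
      -- Concavity of t^(2/d) compares the removed value with an increment; the slope 2/d explains
      -- the factor d/2 in the bound.
      have hpow : (J : ℝ) ^ (2 / d : ℝ) ≤
          n ^ (2 / d : ℝ) - 2 / d * n ^ (2 / d - 1 : ℝ) := by
        rw [hJn, Real.mul_rpow hn0.le (by linarith), Real.rpow_sub_one hn0.ne']
        refine (mul_le_mul_of_nonneg_left hber (by positivity)).trans (le_of_eq ?_)
        ring
      have := mul_le_mul_of_nonneg_left hpow (by positivity : 0 ≤ 192 * d / ξ * (d / 2))
      have e : 192 * d / ξ * (d / 2) * (2 / d * n ^ (2 / d - 1 : ℝ)) =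
          192 * d / ξ * n ^ (2 / d - 1 : ℝ) := by
        field_simp
      linarith

/-- The sum of the potential over a set of mass at most `V` is of order `V ^ (2/d)`. -/
theorem sum_mul_le_rpow (hd : 3 ≤ d) (h : IsSubpotential w U u) {ξ M b V : ℝ} (hξ : 0 < ξ) {N : ℕ}
    (hiso : StrongIsoperimetry w ξ N) (hM0 : 0 ≤ M) (hu0 : ∀ y, 0 ≤ u y) (hM : ∀ y, u y ≤ M)
    {m : (Fin d → ℤ) → ℝ} (hm0 : ∀ y, 0 ≤ m y) (hmb : ∀ y, m y ≤ b) (hb : 0 ≤ b)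
    {B : Finset (Fin d → ℤ)} (hV : ∑ y ∈ B, m y ≤ V) (hV1 : 1 ≤ V) (hNV : (N : ℝ) ≤ V) :
    ∑ y ∈ B, m y * u y ≤
      (2 * (192 * d / ξ) + b * (192 * d / ξ * d)) * V ^ (2 / d : ℝ) + b * (N * M) := by
  have hd3 : (3 : ℝ) ≤ d := by exact_mod_cast hd
  have hd0 : (0 : ℝ) < d := by linarith
  have hda : (2 : ℝ) / d ≤ 1 := by rw [div_le_one hd0]; linarith
  set K : ℝ := 192 * d / ξ with hK
  have hK0 : 0 < K := by positivity
  have hV0 : 0 < V := by linarith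
  set J := ⌈V⌉₊ with hJ
  have hVJ : V ≤ J := Nat.le_ceil V
  have hJV : (J : ℝ) ≤ 2 * V := by
    have := Nat.ceil_lt_add_one hV0.le
    linarith
  have hJ1 : 1 ≤ J := by
    have : (1 : ℝ) ≤ J := hV1.trans hVJ
    exact_mod_cast this
  have hNJ : N ≤ J := by exact_mod_cast hNV.trans hVJ
  have hJ0 : (0 : ℝ) < J := by exact_mod_cast hJ1
  -- Twice the height bound for `J` points, so that the superlevel set cannot have `J` points or
  -- more.
  set s : ℝ := 2 * (K * (J : ℝ) ^ (2 / d - 1 : ℝ)) with hs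
  have hs0 : 0 < s := by positivity
  have hlev : (superlevel U u s).card ≤ J := by
    by_contra hlt
    have := h.height_le_of_le hd hξ hiso hs0.le hJ1 hNJ (by omega)
    linarith
  rw [← Finset.sum_filter_add_sum_filter_not B (fun y => s < u y)]
  have h1 : ∑ y ∈ B.filter (fun y => s < u y), m y * u y ≤
      b * (N * M + K * (d / 2) * (2 * V ^ (2 / d : ℝ))) := by
    calc ∑ y ∈ B.filter (fun y => s < u y), m y * u y
        ≤ ∑ y ∈ B.filter (fun y => s < u y), b * u y :=
          Finset.sum_le_sum fun y _ => mul_le_mul_of_nonneg_right (hmb y) (hu0 y)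
      _ = b * ∑ y ∈ B.filter (fun y => s < u y), u y := by rw [Finset.mul_sum]
      _ ≤ b * (N * M + K * (d / 2) * (2 * V ^ (2 / d : ℝ))) := by
          gcongr
          refine (h.sum_le_card_rpow hd hξ hiso hM0 hM _).trans ?_
          gcongr
          have hc : ((B.filter fun y => s < u y).card : ℝ) ≤ 2 * V := by
            refine le_trans ?_ hJV
            have hsub : B.filter (fun y => s < u y) ⊆ superlevel U u s := fun y hy =>
              (h.mem_superlevel hs0.le).2 (Finset.mem_filter.1 hy).2
            exact_mod_cast (Finset.card_le_card hsub).trans hlev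
          refine (Real.rpow_le_rpow (by positivity) hc (by positivity)).trans ?_
          rw [Real.mul_rpow (by norm_num) hV0.le]
          gcongr
          refine (Real.rpow_le_rpow_of_exponent_le (by norm_num) hda).trans ?_
          rw [Real.rpow_one]
  have h2 : ∑ y ∈ B.filter (fun y => ¬ s < u y), m y * u y ≤ 2 * K * V ^ (2 / d : ℝ) := by
    calc ∑ y ∈ B.filter (fun y => ¬ s < u y), m y * u y
        ≤ ∑ y ∈ B.filter (fun y => ¬ s < u y), m y * s :=
          Finset.sum_le_sum fun y hy =>
            mul_le_mul_of_nonneg_left (not_lt.1 (Finset.mem_filter.1 hy).2) (hm0 y)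
      _ = (∑ y ∈ B.filter (fun y => ¬ s < u y), m y) * s := by rw [Finset.sum_mul]
      _ ≤ V * s := by
          gcongr
          exact (Finset.sum_le_sum_of_subset_of_nonneg (Finset.filter_subset _ _)
            fun y _ _ => hm0 y).trans hV
      _ ≤ V * (2 * (K * V ^ (2 / d - 1 : ℝ))) := by
          rw [hs]
          gcongr V * (2 * (K * ?_))
          exact Real.rpow_le_rpow_of_nonpos hV0 hVJ (by linarith)
      _ = 2 * K * V ^ (2 / d : ℝ) := by
          rw [Real.rpow_sub_one hV0.ne']
          field_simp
  linarith

end IsSubpotential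

/-! ### The walk and its Green density -/

theorem latticeGraph_adj_iff {d : ℕ} {x z : Fin d → ℤ} :
    (latticeGraph d).Adj x z ↔ ∃ i, z = x + unitVec i ∨ z = x - unitVec i := by
  constructor
  · intro h
    have hsum : ∑ j, |x j - z j| = 1 := h
    obtain ⟨i, -, hi⟩ := Finset.exists_ne_zero_of_sum_ne_zero (hsum.trans_ne one_ne_zero)
    have hi1 : 1 ≤ |x i - z i| := Int.one_le_abs (abs_ne_zero.1 hi)
    rw [← Finset.add_sum_erase _ _ (Finset.mem_univ i)] at hsum
    have hnn : 0 ≤ ∑ j ∈ Finset.univ.erase i, |x j - z j| :=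
      Finset.sum_nonneg fun _ _ => abs_nonneg _
    have h0 : ∑ j ∈ Finset.univ.erase i, |x j - z j| = 0 := by omega
    have hi2 : |x i - z i| = 1 := by omega
    rw [Finset.sum_eq_zero_iff_of_nonneg fun _ _ => abs_nonneg _] at h0
    have hj : ∀ j, j ≠ i → z j = x j := fun j hj => by
      have := abs_eq_zero.1 (h0 j (Finset.mem_erase.2 ⟨hj, Finset.mem_univ j⟩))
      omega
    refine ⟨i, ?_⟩
    rcases (abs_eq zero_le_one).1 hi2 with h1 | h1
    · right
      ext j
      rcases eq_or_ne j i with rfl | hne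
      · simp; omega
      · simp [hne, hj j hne]
    · left
      ext j
      rcases eq_or_ne j i with rfl | hne
      · simp; omega
      · simp [hne, hj j hne]
  · rintro ⟨i, rfl | rfl⟩
    · exact latticeGraph_adj_add x i
    · have := latticeGraph_adj_add (x - unitVec i) i
      rw [sub_add_cancel] at this
      exact this.symm

namespace Environment

variable {d : ℕ} (ω : Environment d)

theorem cond_add (x : Fin d → ℤ) (i : Fin d) :
    ω.cond x (x + unitVec i) = ω (latticeEdge (x, i)) := by
  rw [cond, dif_pos (latticeGraph_adj_add x i)]
  rfl

theorem cond_comm (x y : Fin d → ℤ) : ω.cond x y = ω.cond y x := by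
  unfold cond
  by_cases h : (latticeGraph d).Adj x y
  · rw [dif_pos h, dif_pos h.symm]
    congr 3
    exact Sym2.eq_swap
  · rw [dif_neg h, dif_neg fun h' => h h'.symm]

theorem cond_sub (x : Fin d → ℤ) (i : Fin d) :
    ω.cond x (x - unitVec i) = ω (latticeEdge (x - unitVec i, i)) := by
  rw [cond_comm]
  conv_lhs => rw [show x = x - unitVec i + unitVec i by simp]
  rw [add_sub_cancel_right, cond_add]

theorem tsum_mul_cond (g : (Fin d → ℤ) → ℝ≥0∞) (x : Fin d → ℤ) :
    ∑' z, g z * ω.cond x z = ∑ i, (g (x + unitVec i) * ω (latticeEdge (x, i)) +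
      g (x - unitVec i) * ω (latticeEdge (x - unitVec i, i))) := by
  let nb : Fin d × Bool → (Fin d → ℤ) := fun q =>
    if q.2 then x + unitVec q.1 else x - unitVec q.1
  have hinj : Function.Injective nb := by
    rintro ⟨i, a⟩ ⟨j, b⟩ h
    have h1 := congrFun h i
    have h2 := congrFun h j
    have hij : i = j := by
      by_contra hne
      cases a <;> cases b <;> simp [nb, hne] at h1
    subst hij
    cases a <;> cases b <;> simp [nb] at h1 ⊢ <;> omega
  have hsupp : Function.support (fun z => g z * ω.cond x z) ⊆ Set.range nb := by
    intro z hz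
    have hc : ω.cond x z ≠ 0 := right_ne_zero_of_mul hz
    have hadj : (latticeGraph d).Adj x z := by
      by_contra h
      exact hc (by rw [cond, dif_neg h])
    obtain ⟨i, rfl | rfl⟩ := latticeGraph_adj_iff.1 hadj
    · exact ⟨(i, true), by simp [nb]⟩
    · exact ⟨(i, false), by simp [nb]⟩
  rw [← hinj.tsum_eq hsupp, tsum_fintype, Fintype.sum_prod_type]
  refine Finset.sum_congr rfl fun i _ => ?_
  simp only [Fintype.sum_bool, nb, if_true, Bool.false_eq_true, if_false, cond_add, cond_sub]

theorem mass_eq_sum (x : Fin d → ℤ) :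
    ω.mass x = ∑ i, ((ω (latticeEdge (x, i)) : ℝ≥0∞) + ω (latticeEdge (x - unitVec i, i))) := by
  have := ω.tsum_mul_cond 1 x
  simpa [mass] using this

theorem mass_ne_zero (hω : ∀ p, 0 < ω (latticeEdge p)) (hd : 0 < d) (x : Fin d → ℤ) :
    ω.mass x ≠ 0 := fun hx => by
  rw [mass_eq_sum, Finset.sum_eq_zero_iff] at hx
  have := hx ⟨0, hd⟩ (Finset.mem_univ _)
  exact (hω _).ne' (ENNReal.coe_eq_zero.1 (add_eq_zero.1 this).1)

/-- The probability that the walk started at the origin is at `y` at time `k`. -/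
noncomputable def hitProb (k : ℕ) (y : Fin d → ℤ) : ℝ≥0∞ := ω.walkLaw 0 {X | X k = y}

theorem measurableSet_eval_eq (k : ℕ) (y : Fin d → ℤ) :
    MeasurableSet {X : ℕ → Fin d → ℤ | X k = y} :=
  (measurable_pi_apply k : Measurable fun X : ℕ → Fin d → ℤ => X k) (measurableSet_singleton y)

instance (x : Fin d → ℤ) : IsProbabilityMeasure (ω.walkLaw x) :=
  inferInstanceAs (IsProbabilityMeasure (Kernel.traj (X := fun _ => Fin d → ℤ) ω.pastKernel 0 _))

theorem hitProb_zero (y : Fin d → ℤ) : ω.hitProb 0 y = if y = 0 then 1 else 0 := by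
  classical
  have h := Kernel.traj_map_frestrictLe_apply (X := fun _ => Fin d → ℤ) (κ := ω.pastKernel) 0 0
    (fun _ => 0)
  rw [Kernel.partialTraj_self, Kernel.id_apply] at h
  have hm : MeasurableSet {z : (_ : Finset.Iic 0) → Fin d → ℤ |
      z ⟨0, Finset.mem_Iic.2 le_rfl⟩ = y} :=
    (measurable_pi_apply _ : Measurable fun z : (_ : Finset.Iic 0) → Fin d → ℤ =>
      z ⟨0, Finset.mem_Iic.2 le_rfl⟩) (measurableSet_singleton y)
  have h2 := congrArg (fun μ => μ {z : (_ : Finset.Iic 0) → Fin d → ℤ |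
      z ⟨0, Finset.mem_Iic.2 le_rfl⟩ = y}) h
  rw [Measure.map_apply (by fun_prop) hm, Measure.dirac_apply' _ hm] at h2
  refine h2.trans ?_
  simp only [Set.indicator, Set.mem_ofPred_eq, Pi.one_apply, eq_comm]

theorem stepKernel_apply_singleton (x y : Fin d → ℤ) : ω.stepKernel x {y} = ω.step x y :=
  PMF.toMeasure_apply_singleton _ _ (measurableSet_singleton y)

/-- The Markov property: the trajectory law up to time k + 1 is the law up to time k composed with
one step from `X k`. -/
theorem hitProb_succ (k : ℕ) (y : Fin d → ℤ) :
    ω.hitProb (k + 1) y = ∑' x, ω.step x y * ω.hitProb k x := by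
  have h := Kernel.partialTraj_compProd_eq_map_traj (X := fun _ => Fin d → ℤ) (κ := ω.pastKernel)
    (Nat.zero_le k) (x₀ := fun _ => 0)
  have hm : MeasurableSet (Prod.snd ⁻¹' {y} :
      Set (((_ : Finset.Iic k) → Fin d → ℤ) × (Fin d → ℤ))) :=
    measurable_snd (measurableSet_singleton y)
  have h2 := congrArg (fun μ => μ (Prod.snd ⁻¹' {y})) h
  rw [Measure.map_apply (by fun_prop) hm, Measure.compProd_apply hm] at h2
  refine h2.symm.trans ?_
  rw [← Kernel.traj_map_frestrictLe_apply, lintegral_map (Kernel.measurable_kernel_prodMk_left hm)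
    (by fun_prop)]
  have h3 : ∀ X : ℕ → Fin d → ℤ, ω.pastKernel k (Preorder.frestrictLe k X)
      (Prod.mk (Preorder.frestrictLe (π := fun _ => Fin d → ℤ) k X) ⁻¹' (Prod.snd ⁻¹' {y})) =
      ω.step (X k) y :=
    fun X => ω.stepKernel_apply_singleton (X k) y
  simp_rw [h3]
  change ∫⁻ X, ω.step (X k) y ∂ω.walkLaw 0 = _
  rw [← lintegral_map (f := fun x => ω.step x y) (measurable_of_countable _)
    (measurable_pi_apply k), lintegral_countable']
  refine tsum_congr fun x => ?_
  rw [Measure.map_apply (measurable_pi_apply k) (measurableSet_singleton x)]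
  rfl

theorem lintegral_occupationTime (B : Set (Fin d → ℤ)) :
    ∫⁻ X, (occupationTime B X : ℝ≥0∞) ∂ω.walkLaw 0 = ∑' k, ∑' y : B, ω.hitProb k y := by
  have h1 : ∀ X : ℕ → Fin d → ℤ, (occupationTime B X : ℝ≥0∞) =
      ∑' k, Set.indicator {X : ℕ → Fin d → ℤ | X k ∈ B} 1 X := fun X => by
    rw [occupationTime, ← Measure.count_apply (by measurability), ← lintegral_indicator_one
      (by measurability), lintegral_count]
    rfl
  have hm : ∀ k, MeasurableSet {X : ℕ → Fin d → ℤ | X k ∈ B} := fun k =>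
    measurable_pi_apply k B.to_countable.measurableSet
  simp_rw [h1]
  rw [lintegral_tsum fun k => (measurable_one.indicator (hm k)).aemeasurable]
  refine tsum_congr fun k => ?_
  rw [lintegral_indicator_one (hm k)]
  exact (tsum_measure_preimage_singleton B.to_countable
    fun y _ => measurableSet_eval_eq k y).symm

theorem hitProb_le_one (k : ℕ) (y : Fin d → ℤ) : ω.hitProb k y ≤ 1 := prob_le_one

theorem step_apply {x : Fin d → ℤ} (hx : ω.mass x ≠ 0) (y : Fin d → ℤ) :
    ω.step x y = ω.cond x y * (ω.mass x)⁻¹ := by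
  rw [step, dif_neg hx]
  exact PMF.normalize_apply _ _ _

/-- Finite propagation speed; it gives the truncated Green density finite support. -/
theorem hitProb_eq_zero (hω : ∀ x, ω.mass x ≠ 0) {k n : ℕ} (hk : k ≤ n) {y : Fin d → ℤ}
    (hy : y ∉ Finset.Icc (fun _ : Fin d => -(n : ℤ)) fun _ => n) : ω.hitProb k y = 0 := by
  have key : ∀ k y, ω.hitProb k y ≠ 0 → ∀ j, |y j| ≤ (k : ℤ) := by
    intro k
    induction k with
    | zero =>
      intro y hy j
      have : y = 0 := by
        by_contra h
        exact hy (by rw [hitProb_zero, if_neg h])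
      simp [this]
    | succ k ih =>
      intro y hy j
      rw [hitProb_succ] at hy
      obtain ⟨x, hx⟩ : ∃ x, ω.step x y * ω.hitProb k x ≠ 0 := by
        by_contra hc
        push Not at hc
        exact hy (ENNReal.tsum_eq_zero.2 hc)
      have h1 := ih x (right_ne_zero_of_mul hx) j
      have h2 : ω.cond x y ≠ 0 := by
        have := left_ne_zero_of_mul hx
        rw [ω.step_apply (hω x)] at this
        exact left_ne_zero_of_mul this
      have hadj : (latticeGraph d).Adj x y := by
        by_contra h
        exact h2 (by rw [cond, dif_neg h])
      have hsum : ∑ l, |x l - y l| = 1 := hadj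
      have h3 : |x j - y j| ≤ 1 := hsum ▸
        Finset.single_le_sum (f := fun l => |x l - y l|) (fun l _ => abs_nonneg _)
          (Finset.mem_univ j)
      rw [abs_le] at *
      push_cast
      omega
  by_contra h
  refine hy (Finset.mem_Icc.2 ⟨fun j => ?_, fun j => ?_⟩) <;>
    have := abs_le.1 (key k y h j) <;> simp only <;> omega

/-- The conductance of an edge as a real number. -/
def weight (p : (Fin d → ℤ) × Fin d) : ℝ := ω (latticeEdge p)

theorem toReal_mass (x : Fin d → ℤ) :
    (ω.mass x).toReal = ∑ i, (ω.weight (x, i) + ω.weight (x - unitVec i, i)) := by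
  rw [mass_eq_sum, ENNReal.toReal_sum fun i _ => by finiteness]
  refine Finset.sum_congr rfl fun i _ => ?_
  rw [ENNReal.toReal_add (by finiteness) (by finiteness)]
  rfl

/-- The density of the walk at time `k` with respect to the reversible measure. -/
noncomputable def density (k : ℕ) (y : Fin d → ℤ) : ℝ := (ω.hitProb k y).toReal / (ω.mass y).toReal

/-- Reversibility: as conductances are symmetric, the forward equation becomes a
conductance-weighted sum of the density over the neighbours. -/
theorem mass_mul_density_succ (hω : ∀ x, ω.mass x ≠ 0) (k : ℕ) (y : Fin d → ℤ) :
    (ω.hitProb (k + 1) y).toReal = ∑ i, (ω.density k (y + unitVec i) * ω.weight (y, i) +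
      ω.density k (y - unitVec i) * ω.weight (y - unitVec i, i)) := by
  have h1 : ω.hitProb (k + 1) y = ∑' x, (ω.hitProb k x / ω.mass x) * ω.cond y x := by
    rw [hitProb_succ]
    refine tsum_congr fun x => ?_
    rw [ω.step_apply (hω x), ω.cond_comm x y, div_eq_mul_inv]
    ring
  have hfin : ∀ x, ω.hitProb k x / ω.mass x ≠ ∞ := fun x =>
    ENNReal.div_ne_top (ne_top_of_le_ne_top ENNReal.one_ne_top (ω.hitProb_le_one k x)) (hω x)
  have hreal : ∀ x, (ω.hitProb k x / ω.mass x).toReal = ω.density k x := fun x =>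
    ENNReal.toReal_div _ _
  have hterm : ∀ x p, ω.hitProb k x / ω.mass x * (ω (latticeEdge p) : ℝ≥0∞) ≠ ∞ := fun x p =>
    ENNReal.mul_ne_top (hfin x) ENNReal.coe_ne_top
  rw [h1, tsum_mul_cond, ENNReal.toReal_sum fun i _ =>
    ENNReal.add_ne_top.2 ⟨hterm _ _, hterm _ _⟩]
  refine Finset.sum_congr rfl fun i _ => ?_
  rw [ENNReal.toReal_add (hterm _ _) (hterm _ _), ENNReal.toReal_mul, ENNReal.toReal_mul, hreal,
    hreal]
  rfl

/-- The Green density truncated at time `n` is the potential of a unit source up to sinks. -/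
theorem isSubpotential_sum_density (hω : ∀ p, 0 < ω (latticeEdge p)) (hd : 0 < d) (n : ℕ) :
    IsSubpotential ω.weight (Finset.Icc (fun _ : Fin d => -(n : ℤ)) fun _ => n)
      fun y => ∑ k ∈ Finset.range n, ω.density k y := by
  have hmass := ω.mass_ne_zero hω hd
  refine ⟨fun p => hω p, fun y hy => ?_, fun y => ?_⟩
  · refine Finset.sum_eq_zero fun k hk => ?_
    rw [density, ω.hitProb_eq_zero hmass (Finset.mem_range.1 hk).le hy]
    simp
  · have h1 : currentDiv ω.weight (fun y => ∑ k ∈ Finset.range n, ω.density k y) y =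
        ∑ k ∈ Finset.range n,
          ((ω.hitProb k y).toReal - (ω.hitProb (k + 1) y).toReal) := by
      have h2 : ∀ k, (ω.hitProb k y).toReal =
          ∑ i, (ω.weight (y, i) + ω.weight (y - unitVec i, i)) * ω.density k y := fun k => by
        rw [← Finset.sum_mul, ← toReal_mass, density]
        have : (ω.mass y).toReal ≠ 0 := (ENNReal.toReal_pos (hmass y) (ω.mass_ne_top y)).ne'
        field_simp
      simp_rw [ω.mass_mul_density_succ hmass, h2, ← Finset.sum_sub_distrib]
      rw [Finset.sum_comm]
      refine Finset.sum_congr rfl fun i _ => ?_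
      simp only [edgeCurrent, sub_add_cancel]
      rw [← Finset.sum_sub_distrib, ← Finset.sum_sub_distrib, Finset.mul_sum, Finset.mul_sum,
        ← Finset.sum_sub_distrib]
      refine Finset.sum_congr rfl fun k _ => ?_
      ring
    rw [h1, Finset.sum_range_sub', hitProb_zero]
    have : 0 ≤ (ω.hitProb n y).toReal := ENNReal.toReal_nonneg
    split_ifs <;> simp [this]

end Environment

/-! ### From the potential to the occupation time -/

theorem ae_forall_latticeEdge {d : ℕ} (ν : Measure ℝ≥0) [IsProbabilityMeasure ν] {P : ℝ≥0 → Prop}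
    (hP : ∀ᵐ a ∂ν, P a) : ∀ᵐ ω ∂iidLaw d ν, ∀ p, P (ω (latticeEdge p)) :=
  ae_all_iff.2 fun p =>
    (measurePreserving_eval_infinitePi (fun _ => ν) (latticeEdge p)).quasiMeasurePreserving.ae hP

namespace Environment

variable {d : ℕ} (ω : Environment d)

theorem density_nonneg (k : ℕ) (y : Fin d → ℤ) : 0 ≤ ω.density k y :=
  div_nonneg ENNReal.toReal_nonneg ENNReal.toReal_nonneg

theorem toReal_mass_le {M : ℝ≥0} (hM : ∀ p, ω (latticeEdge p) ≤ M) (x : Fin d → ℤ) :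
    (ω.mass x).toReal ≤ 2 * d * M := by
  rw [toReal_mass]
  refine (Finset.sum_le_sum (g := fun _ => (2 * M : ℝ)) fun i _ => ?_).trans (le_of_eq ?_)
  · have h1 : ω.weight (x, i) ≤ M := hM _
    have h2 : ω.weight (x - unitVec i, i) ≤ M := hM _
    linarith
  · simp; ring

/-- Reduction to finite time and finite subsets by monotone limits, which allows infinite `B`. -/
theorem sum_hitProb_le {C : ℝ≥0∞} (B : Set (Fin d → ℤ))
    (h : ∀ n, ∀ F : Finset (Fin d → ℤ), ↑F ⊆ B →
      ∑ y ∈ F, ∑ k ∈ Finset.range n, ω.hitProb k y ≤ C) :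
    ∫⁻ X, (occupationTime B X : ℝ≥0∞) ∂ω.walkLaw 0 ≤ C := by
  classical
  rw [lintegral_occupationTime, ENNReal.tsum_eq_iSup_nat]
  refine iSup_le fun n => ?_
  rw [← Summable.tsum_finsetSum fun _ _ => ENNReal.summable, ENNReal.tsum_eq_iSup_sum]
  refine iSup_le fun F => ?_
  have := h n (F.map (Function.Embedding.subtype _)) (by simp)
  rwa [Finset.sum_map] at this

/-- The occupation time bound for a fixed environment with strong isoperimetry. -/
theorem exists_lintegral_occupationTime_le (hd : 3 ≤ d) {ξ : ℝ} (hξ : 0 < ξ) {M : ℝ≥0} {N : ℕ}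
    (hpos : ∀ p, 0 < ω (latticeEdge p)) (hM : ∀ p, ω (latticeEdge p) ≤ M)
    (hiso : StrongIsoperimetry ω.weight ξ N) :
    ∃ N' : ℕ, ∀ B : Set (Fin d → ℤ), (N' : ℝ≥0∞) ≤ ω.vol B →
      ∫⁻ X, (occupationTime B X : ℝ≥0∞) ∂ω.walkLaw 0 ≤
        ENNReal.ofReal (2 * (192 * d / ξ) + 2 * d * M * (192 * d / ξ * d) + 1) *
          ω.vol B ^ (2 / d : ℝ) := by
  have hd0 : (0 : ℝ) < d := by exact_mod_cast (by omega : 0 < d)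
  obtain ⟨κ, hκ, hκw⟩ : ∃ κ : ℝ, 0 < κ ∧ ∀ k < N,
      κ ≤ ω.weight (Pi.single ⟨0, by omega⟩ (k : ℤ), ⟨0, by omega⟩) := by
    rcases Nat.eq_zero_or_pos N with rfl | hN
    · exact ⟨1, one_pos, fun k hk => absurd hk (Nat.not_lt_zero k)⟩
    · obtain ⟨k, -, hmin⟩ := Finset.exists_min_image (Finset.range N)
        (fun k : ℕ => ω.weight (Pi.single ⟨0, by omega⟩ (k : ℤ), ⟨0, by omega⟩))
        ⟨0, Finset.mem_range.2 hN⟩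
      exact ⟨_, hpos _, fun j hj => hmin j (Finset.mem_range.2 hj)⟩
  have hsub := ω.isSubpotential_sum_density hpos (by omega)
  have hmass := ω.mass_ne_zero hpos (by omega)
  set T : ℝ := 192 * d / ξ + N * (2 / κ) with hT
  have hT0 : 0 ≤ T := by positivity
  set b : ℝ := 2 * d * M with hb
  have hb0 : 0 ≤ b := by positivity
  set K : ℝ := 2 * (192 * d / ξ) + b * (192 * d / ξ * d) with hK
  have hK0 : 0 ≤ K := by positivity
  -- The power d/2 inverts 2/d: the ω-dependent remainder b N T is then at most V^(2/d), which is
  -- the + 1 in the constant.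
  obtain ⟨N', hN'⟩ := exists_nat_ge (max (max 1 (N : ℝ)) ((b * (N * T)) ^ ((d : ℝ) / 2)))
  refine ⟨N', fun B hB => ?_⟩
  rcases eq_or_ne (ω.vol B) ∞ with htop | hfin
  · rw [htop, ENNReal.top_rpow_of_pos (by positivity), ENNReal.mul_top]
    · exact le_top
    · rw [ne_eq, ENNReal.ofReal_eq_zero, not_le]
      positivity
  set V := (ω.vol B).toReal with hV
  have hVof : ω.vol B = ENNReal.ofReal V := (ENNReal.ofReal_toReal hfin).symm
  have hN'V : (N' : ℝ) ≤ V := by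
    rw [hV, ← ENNReal.ofReal_le_iff_le_toReal hfin, ENNReal.ofReal_natCast]
    exact hB
  have hmax := hN'.trans hN'V
  rw [max_le_iff, max_le_iff] at hmax
  obtain ⟨⟨hV1, hVN⟩, hVT⟩ := hmax
  have hV0 : 0 < V := by linarith
  have hrest : b * (N * T) ≤ V ^ (2 / d : ℝ) := by
    have h1 := Real.rpow_le_rpow (by positivity) hVT (by positivity : (0 : ℝ) ≤ 2 / d)
    have h2 : (d : ℝ) / 2 * (2 / d) = 1 := by field_simp
    rwa [← Real.rpow_mul (by positivity), h2, Real.rpow_one] at h1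
  rw [hVof, ENNReal.ofReal_rpow_of_pos hV0, ← ENNReal.ofReal_mul (by positivity)]
  refine ω.sum_hitProb_le B fun n F hF => ?_
  have hFV : ∑ y ∈ F, (ω.mass y).toReal ≤ V := by
    rw [← ENNReal.toReal_sum fun y _ => ω.mass_ne_top y]
    refine ENNReal.toReal_mono hfin ?_
    rw [vol, tsum_subtype]
    refine le_trans (Finset.sum_le_sum fun y hy => ?_) (ENNReal.sum_le_tsum F)
    rw [Set.indicator_of_mem (hF hy)]
  have hbound := (hsub n).sum_mul_le_rpow hd hξ hiso hT0
    (fun y => Finset.sum_nonneg fun k _ => ω.density_nonneg k y)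
    ((hsub n).le_of_strongIsoperimetry hd hξ hκ hiso hκw)
    (fun y => ENNReal.toReal_nonneg) (ω.toReal_mass_le hM) hb0 hFV hV1 hVN
  have hsum : ∑ y ∈ F, ∑ k ∈ Finset.range n, ω.hitProb k y = ENNReal.ofReal
      (∑ y ∈ F, (ω.mass y).toReal * ∑ k ∈ Finset.range n, ω.density k y) := by
    rw [ENNReal.ofReal_sum_of_nonneg fun y _ => mul_nonneg ENNReal.toReal_nonneg
      (Finset.sum_nonneg fun k _ => ω.density_nonneg k y)]
    refine Finset.sum_congr rfl fun y _ => ?_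
    rw [Finset.mul_sum, ENNReal.ofReal_sum_of_nonneg fun k _ =>
      mul_nonneg ENNReal.toReal_nonneg (ω.density_nonneg k y)]
    refine Finset.sum_congr rfl fun k _ => ?_
    rw [density, mul_div_cancel₀ _ (ENNReal.toReal_pos (hmass y) (ω.mass_ne_top y)).ne',
      ENNReal.ofReal_toReal (ne_top_of_le_ne_top ENNReal.one_ne_top (ω.hitProb_le_one k y))]
  rw [hsum]
  refine ENNReal.ofReal_le_ofReal (hbound.trans ?_)
  rw [← hK]
  linarith

end Environment

theorem propositionp1 (d : ℕ) (hd : 3 ≤ d) (ν : Measure ℝ≥0) [IsProbabilityMeasure ν]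
    (hpos : ∀ᵐ a ∂ν, 0 < a) (hbdd : ∃ M : ℝ≥0, ∀ᵐ a ∂ν, a ≤ M) :
    ∃ C : ℝ≥0, 0 < C ∧ ∀ᵐ ω ∂(iidLaw d ν), ∃ N : ℕ, ∀ B : Set (Fin d → ℤ),
      (0 : Fin d → ℤ) ∈ B → ((latticeGraph d).induce B).Connected → (N : ℝ≥0∞) ≤ ω.vol B →
        ∫⁻ X, (occupationTime B X : ℝ≥0∞) ∂(ω.walkLaw 0) ≤
          (C : ℝ≥0∞) * ω.vol B ^ (2 / d : ℝ) := by
  obtain ⟨M, hM⟩ := hbdd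
  obtain ⟨ξ, hξ, hiso⟩ := ae_exists_strong_isoperimetry hd ν hpos
  have hξ0 : (0 : ℝ) < ξ := hξ
  refine ⟨(2 * (192 * d / ξ) + 2 * d * M * (192 * d / ξ * d) + 1 : ℝ).toNNReal,
    Real.toNNReal_pos.2 (by positivity), ?_⟩
  filter_upwards [hiso, ae_forall_latticeEdge ν hpos, ae_forall_latticeEdge ν hM]
    with ω ⟨N, hN⟩ hωpos hωM
  obtain ⟨N', hN'⟩ := ω.exists_lintegral_occupationTime_le hd hξ0 hωpos hωM hN
  exact ⟨N', fun B _ _ hB => hN' B hB⟩
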